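/- **Theorem (Computational cost of RSS+).** Let $G=(V,E)$ be a finite connected undirected graph with maximum degree $\Delta$, let $3\le k<|V|$, and let $\varepsilon>0$. For $j\ge 1$ let $V^{(j)}$ be the set of connected vertex-induced subgraphs of $G$ with exactly $j$ nodes, and let $G^{(j)}=(V^{(j)},E^{(j)})$ be the $j$-state graph, in which two such subgraphs are adjacent iff they share exactly $j-1$ nodes. For $H\in V^{(j)}$ let $d(H)$ be its degree in $G^{(j)}$, $m(H)$ the number of its connected $(j-1)$-node induced subgraphs, and $f(H)=d(H)/\binom{m(H)}{2}$. *DegreePropSampling+* at level $2$ draws an edge $uv\in E$ with probability proportional to $d(u)+d(v)-2$. At level $j\ge3$, a *proposal* is made as follows: call DegreePropSampling+ at level $j-1$ to get $v$, choose a uniform neighbour $u$ of $v$ in $G^{(j-1)}$, let $H\in V^{(j)}$ be the subgraph on the union of the nodes of $u$ and $v$, and compute $d(H)$, $m(H)$, $f(H)$. The procedure makes one proposal $H_c$, and then repeats $T_j$ times: with probability $\frac12$ do nothing; otherwise make a proposal $H_n$ and replace $H_c$ by $H_n$ with probability $\min\{1,f(H_n)/f(H_c)\}$. It returns $H_c$.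 The algorithm *RSS+* repeats the following until it returns: call DegreePropSampling+ at level $k-1$ to get $v$, choose a uniform neighbour $u$ of $v$ in $G^{(k-1)}$, let $H$ be the subgraph on the union of the nodes of $u$ and $v$, compute $m(H)$, and return $H$ with probability $1/\binom{m(H)}{2}$. The number of steps $T_j$ is the mixing time $t'_j(\varepsilon)$, that is, the least $t$ such that from time $t$ on, from every starting state, the total variation distance to stationarity is at most $\varepsilon$, for the Markov chain on $E^{(j-1)}$ with transition probabilities $p(x,y)=\frac{1}{2|E^{(j-1)}|}\min\{1,f(y)/f(x)\}$ for $y\ne x$ (and $p(x,x)$ the remaining probability) and stationary distribution proportional to $f$, where $f(x)$ for an edge $x$ means $f$ of the union of its ends. Alternatively, $T_j$ is the explicit number $\lceil 2j\Delta(j\ln|V|+3\ln j+\ln\Delta+\ln\varepsilon^{-1})\rceil$. Time is counted as follows. Each random draw and each test $\mathit{random}(0,1)<p$ takes one unit. Each query to $G^{(j)}$ (access to the neighbours of a $j$-subgraph, its degree, or its number of $(j-1)$-subgraphs) takes $\kappa_j$ units, where $\kappa_j\le K$ for $j\le3$ (tabulated data) and $\kappa_j\le K j^4\Delta$ for $j\ge4$.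 Then for every $A>0$ and $K\in\mathbb N$ there are constants $C,c>0$, depending only on $A$ and $K$, such that for all $G$, $k$, $\kappa$ as above, all $\varepsilon\ge|V|^{-A}$, and either choice of the $T_j$, RSS+ stops with probability one and its expected running time is at most $$C\,c^{\,k-3}\,k^2\,((k-1)!)^2\,\Delta^{k-3}\,(\ln|V|)^{k-3}.$$ (In particular this covers every fixed $\varepsilon>0$, with $C,c$ depending on $\varepsilon$ and $K$, and all $\varepsilon\ge 1/|V|$ with $C,c$ depending on $K$ only.) -/

import Mathlib

/-! Randomised programs with a step count, connected `k`-subgraphs and their state graphs, the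
Metropolis-Hastings chain of the recursive sampler, and the sampler itself. -/

namespace RSS

noncomputable section

open scoped Classical ENNReal

/-! ### Randomised programs with a step count -/

/-- A randomised program with output in `α`, given by its behaviour: `p (a, t)` is the probability
that a run stops with output `a` after exactly `t` time units. The missing mass is the probability
that a run never stops or gets stuck. -/
abbrev Prog (α : Type*) : Type _ := α × ℕ → ℝ≥0∞

namespace Prog

variable {α β : Type*}

/-- The program that stops at once with output `a`. -/
def ret (a : α) : Prog α := fun x => if x = (a, 0) then 1 else 0

/-- The program that gets stuck. -/
def fail : Prog α := fun _ => 0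

/-- Sequential composition; running times add up. -/
def bind (p : Prog α) (q : α → Prog β) : Prog β := fun x =>
  ∑' a : α, ∑ st ∈ Finset.HasAntidiagonal.antidiagonal x.2, p (a, st.1) * q a (x.1, st.2)

/-- Spend `n` time units. -/
def spend (n : ℕ) : Prog Unit := fun x => if x.2 = n then 1 else 0

/-- Draw an element with probability proportional to its weight, in one time unit
(stuck if all weights are zero, as `0 / 0 = 0`). -/
def draw [Fintype α] (w : α → ℕ) : Prog α := fun x =>
  if x.2 = 1 then (w x.1 : ℝ≥0∞) / ∑ a, (w a : ℝ≥0∞) else 0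

/-- The test `random(0,1) < p`, in one time unit: true with probability `min p 1`. -/
def flip (p : ℚ) : Prog Bool := fun x =>
  if x.2 = 1 then
    (if x.1 then ENNReal.ofReal (min (p : ℝ) 1) else 1 - ENNReal.ofReal (min (p : ℝ) 1))
  else 0

/-- `for` loop: run `body` on the current state `n` times. -/
def iterate (body : α → Prog α) : ℕ → α → Prog α
  | 0, a => ret a
  | n + 1, a => (body a).bind (iterate body n)

/-- The runs of `while true do body` in which exactly the first `n` rounds return nothing
and the next round returns an output. -/
def rounds (body : Prog (Option α)) : ℕ → Prog α
  | 0 => body.bind fun o => o.elim fail ret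
  | n + 1 => body.bind fun o => o.elim (rounds body n) (fun _ => fail)

/-- `while true do body`, left as soon as `body` returns an output. -/
def repeatUntil (body : Prog (Option α)) : Prog α := fun x => ∑' n, rounds body n x

/-- The probability that the program stops with an output. -/
def haltProb (p : Prog α) : ℝ≥0∞ := ∑' x, p x

/-- The expected running time of a program that stops with probability one. -/
def expectedTime (p : Prog α) : ℝ≥0∞ := ∑' x, p x * (x.2 : ℝ≥0∞)

end Prog

/-! ### Mixing time -/

/-- The least `t` such that from time `t` on the law of the chain started at `x` is within total
variation distance `ε` of `π`. -/
def mixingTimeFrom {Ω : Type*} [Fintype Ω] (P : Matrix Ω Ω ℝ) (π : Ω → ℝ) (ε : ℝ) (x : Ω) : ℕ :=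
  sInf {t : ℕ | ∀ l ≥ t, (1 / 2 : ℝ) * ∑ y, |(P ^ l) x y - π y| ≤ ε}

/-- The worst-case mixing time. -/
def mixingTime {Ω : Type*} [Fintype Ω] (P : Matrix Ω Ω ℝ) (π : Ω → ℝ) (ε : ℝ) : ℕ :=
  Finset.univ.sup (mixingTimeFrom P π ε)

/-! ### Connected subgraphs and state graphs -/

variable {V : Type*} [Fintype V]

/-- The maximum degree of `G`. -/
def maxDeg (G : SimpleGraph V) : ℕ := G.maxDegree

/-- Connected vertex-induced subgraphs of `G` on `k` nodes, given by their vertex sets. -/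
abbrev KSub (G : SimpleGraph V) (k : ℕ) : Type _ :=
  {S : Finset V // S.card = k ∧ (G.induce (S : Set V)).Connected}

/-- The `k`-state graph: two `k`-subgraphs are adjacent if they share exactly `k - 1` nodes. -/
def stateGraph (G : SimpleGraph V) (k : ℕ) : SimpleGraph (KSub G k) where
  Adj H F := (H.1 ∩ F.1).card + 1 = k
  symm := ⟨fun H F h => by rwa [Finset.inter_comm]⟩
  loopless := ⟨fun H h => by rw [Finset.inter_self, H.2.1] at h; omega⟩

/-- The degree of `H` in the `k`-state graph. -/
def stateDeg (G : SimpleGraph V) {k : ℕ} (H : KSub G k) : ℕ := (stateGraph G k).degree H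

/-- The number of connected `(k-1)`-subgraphs of `H`. -/
def numSub (G : SimpleGraph V) {k : ℕ} (H : KSub G k) : ℕ :=
  (Finset.univ.filter fun F : KSub G (k - 1) => F.1 ⊆ H.1).card

/-- `f(H)`, the degree of `H` divided by the number of pairs of its `(k-1)`-subgraphs. -/
def weight (G : SimpleGraph V) {k : ℕ} (H : KSub G k) : ℚ :=
  (stateDeg G H : ℚ) / ((numSub G H).choose 2 : ℚ)

/-- The edge set `E^(k)` of the `k`-state graph. -/
abbrev StateEdge (G : SimpleGraph V) (k : ℕ) : Type _ := (stateGraph G k).edgeSet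

theorem edgeUnion_aux (G : SimpleGraph V) (n : ℕ) (e : StateEdge G (n + 2)) :
    (Finset.univ.filter fun x : V => ∃ v ∈ e.1, x ∈ v.1).card = n + 3 ∧
      (G.induce ((Finset.univ.filter fun x : V => ∃ v ∈ e.1, x ∈ v.1 : Finset V) :
        Set V)).Connected := by
  obtain ⟨e, he⟩ := e
  induction e using Sym2.ind with
  | _ v u =>
    have hadj : (v.1 ∩ u.1).card + 1 = n + 2 := he
    have hset : (Finset.univ.filter fun x : V => ∃ w ∈ s(v, u), x ∈ w.1) = v.1 ∪ u.1 := by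
      ext x
      simp
    rw [hset]
    constructor
    · have h1 := Finset.card_union_add_card_inter v.1 u.1
      have h2 := v.2.1
      have h3 := u.2.1
      omega
    · have hne : (v.1 ∩ u.1).Nonempty := by
        rw [← Finset.card_pos]; omega
      rw [Finset.coe_union]
      refine SimpleGraph.induce_union_connected v.2.2.preconnected u.2.2.preconnected ?_
      rw [← Finset.coe_inter]
      exact_mod_cast hne

/-- The subgraph whose nodes are the union of the two ends of an edge of a state graph. -/
def edgeUnion (G : SimpleGraph V) {n : ℕ} (e : StateEdge G (n + 2)) : KSub G (n + 3) :=
  ⟨Finset.univ.filter fun x : V => ∃ v ∈ e.1, x ∈ v.1, edgeUnion_aux G n e⟩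

/-! ### The Metropolis-Hastings chain on `E^(k-1)`, for `k = n + 3` -/

/-- The transition matrix: stay with probability `1/2`, otherwise propose a uniform edge `y` and
accept it with probability `min 1 (f y / f x)`. -/
def chain (G : SimpleGraph V) (n : ℕ) : Matrix (StateEdge G (n + 2)) (StateEdge G (n + 2)) ℝ :=
  let p : StateEdge G (n + 2) → StateEdge G (n + 2) → ℝ := fun x y =>
    1 / (2 * (Fintype.card (StateEdge G (n + 2)) : ℝ)) *
      min 1 ((weight G (edgeUnion G y) : ℝ) / (weight G (edgeUnion G x) : ℝ))
  fun x y => if x = y then 1 - ∑ z ∈ Finset.univ.erase x, p x z else p x y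

/-- The target distribution, proportional to `f`. -/
def target (G : SimpleGraph V) (n : ℕ) (x : StateEdge G (n + 2)) : ℝ :=
  (weight G (edgeUnion G x) : ℝ) / ∑ y : StateEdge G (n + 2), (weight G (edgeUnion G y) : ℝ)

/-- The mixing time `t'_k(ε)` of the chain of level `k` (there is a chain only for `k ≥ 3`). -/
def mixSteps (G : SimpleGraph V) (ε : ℝ) : ℕ → ℕ
  | n + 3 => mixingTime (chain G n) (target G n) ε
  | _ => 0

/-- The explicit number of steps `⌈2kΔ(k ln|V| + 3 ln k + ln Δ + ln ε⁻¹)⌉` at level `k`. -/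
def explicitSteps (G : SimpleGraph V) (ε : ℝ) (k : ℕ) : ℕ :=
  ⌈2 * (k : ℝ) * (maxDeg G : ℝ) * ((k : ℝ) * Real.log (Fintype.card V) + 3 * Real.log k +
    Real.log (maxDeg G) + Real.log ε⁻¹)⌉₊

/-! ### The algorithm

`κ j` is the time of one query to the `j`-state graph (the neighbours or the degree of a
`j`-subgraph, or the number of its `(j-1)`-subgraphs), and `T j` is the number of steps of the
random walk at level `j`. Every random draw and every test `random(0,1) < p` takes one time unit. -/

variable (G : SimpleGraph V) (κ : ℕ → ℕ) (T : ℕ → ℕ)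

/-- From a `(n+2)`-subgraph `v`, sample a uniform neighbour `u` of `v` in the state graph and
return the `(n+3)`-subgraph on the union of their nodes. -/
def extend {n : ℕ} (v : KSub G (n + 2)) : Prog (KSub G (n + 3)) :=
  (Prog.spend (κ (n + 2))).bind fun _ =>
  (Prog.draw fun _ : (stateGraph G (n + 2)).neighborSet v => 1).bind fun u =>
  Prog.ret (edgeUnion G ⟨s(v, u.1), u.2⟩)

/-- Query the degree of `H` in its state graph. -/
def queryDeg {k : ℕ} (H : KSub G k) : Prog ℕ :=
  (Prog.spend (κ k)).bind fun _ => Prog.ret (stateDeg G H)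

/-- Query the number of `(k-1)`-subgraphs of `H`. -/
def queryNumSub {k : ℕ} (H : KSub G k) : Prog ℕ :=
  (Prog.spend (κ k)).bind fun _ => Prog.ret (numSub G H)

/-- A proposal `(H, f)` of level `n + 3`, made from one sample of level `n + 2`. -/
def propose {n : ℕ} (sample : Prog (KSub G (n + 2))) : Prog (KSub G (n + 3) × ℚ) :=
  sample.bind fun v =>
  (extend G κ v).bind fun H =>
  (queryDeg G κ H).bind fun d =>
  (queryNumSub G κ H).bind fun m =>
  Prog.ret (H, (d : ℚ) / (m.choose 2 : ℚ))

/-- One step of the random walk of level `n + 3` from the current state `(H_c, f_c)`. -/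
def walkStep {n : ℕ} (sample : Prog (KSub G (n + 2))) (c : KSub G (n + 3) × ℚ) :
    Prog (KSub G (n + 3) × ℚ) :=
  (Prog.flip (1 / 2)).bind fun skip =>
  if skip then Prog.ret c else
    (propose G κ sample).bind fun x =>
    (Prog.flip (x.2 / c.2)).bind fun accept =>
    Prog.ret (if accept then x else c)

/-- `DegreePropSampling+`: at level `2` draw an edge `uv` with weight `d(u) + d(v) - 2`, above it
run the walk for `T k` steps, with proposals made by recursive calls. -/
def degreePropSamplingPlus : (k : ℕ) → Prog (KSub G k)
  | 0 => Prog.fail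
  | 1 => Prog.fail
  | 2 => Prog.draw fun e : KSub G 2 => (∑ x ∈ e.1, G.degree x) - 2
  | n + 3 =>
    (propose G κ (degreePropSamplingPlus (n + 2))).bind fun c =>
    (Prog.iterate (walkStep G κ (degreePropSamplingPlus (n + 2))) (T (n + 3)) c).bind fun x =>
    Prog.ret x.1

/-- `RSS+`: `UniformSampling` with `DegreePropSampling+` as its subroutine. -/
def rssPlus : (k : ℕ) → Prog (KSub G k)
  | 0 => Prog.fail
  | 1 => Prog.fail
  | 2 => Prog.draw fun _ => 1
  | n + 3 => Prog.repeatUntil <|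
    (degreePropSamplingPlus G κ T (n + 2)).bind fun v =>
    (extend G κ v).bind fun H =>
    (queryNumSub G κ H).bind fun m =>
    (Prog.flip (1 / (m.choose 2 : ℚ))).bind fun accept =>
    Prog.ret (if accept then some H else none)

/-- The program stops with probability one, in expected time at most `B`. -/
def RunsInExpectedTime {α : Type*} (p : Prog α) (B : ℝ) : Prop :=
  p.haltProb = 1 ∧ p.expectedTime ≤ ENNReal.ofReal B

/-- Time of the queries: constant at levels up to `3`, where the answers are tabulated in advance
like the edge weights of level `2`; above, at most the time `k ^ 4 * Δ` of going through all
`k ^ 2 * Δ` exchanges of one node and testing connectedness in time `k ^ 2`. -/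
def QueryCost (K : ℕ) : Prop :=
  (∀ j ≤ 3, κ j ≤ K) ∧ ∀ j ≥ 4, κ j ≤ K * j ^ 4 * maxDeg G

end

end RSS

/-! The expected running time of `RSS+`.

The subroutines stop with probability one, and their expected times add up under composition
(`Prog.RunsIn.bind`), so the time `S j` of a sample of level `j` obeys
`S j ≤ (T j + 1) * (S (j - 1) + a j)`, where `a j` is the cost of the queries of a step. Rejection
in `RSS+` costs a factor at most `k choose 2` (`Prog.RunsIn.repeatUntil`), since the union `H` of
two adjacent subgraphs has at least two and at most `k` connected subgraphs on `k - 1` nodes. No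
draw gets stuck, because a connected subgraph on fewer than `|V|` nodes has a neighbour in its
state graph (`stateDeg_pos`).

For the explicit number of steps, `T j + 1` is at most a constant times `j ^ 2 * Δ * log |V|`, and
the recursion gives the bound at once. The mixing time of a single level may be longer than that,
but the excess telescopes over the levels. The chain of level `j` is an independence sampler with
uniform proposals on `E^(j-1)`, so its transition matrix dominates `β` times the stationary
distribution, where `β` is half the mean of `f` divided by a bound for its maximum, and the
distance to stationarity after `t` steps is at most `(1 - β) ^ t` (`sum_abs_pow_sub_le`). The
maximum of `f` is at most `j ^ 2 * Δ` (`weight_le`). In the sum of `f` over `E^(j-1)`, each `H`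
occurs at least once for every pair of its connected `(j-1)`-subgraphs, which cancels the
denominator of `f H`, so the sum is at least the sum of the degrees in `G^(j)`, that is
`2 * |E^(j)|` (`two_mul_card_le_sum_weight`). Hence `T j + 1` is at most a constant times
`j ^ 2 * Δ * log |V| * |E^(j-1)| / |E^(j)|`, and in the product over the levels `i, …, k - 1` only
the quotient `|E^(i-1)| / |E^(k-1)|` is left (`timeBound_mul_le`). It is at most exponential in
`k`, since every connected set grows to connected sets of all larger sizes, and a set of `k - 1`
nodes has only `2 ^ (k - 1)` subsets (`card_stateEdge_le_of_le`). -/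

namespace RSS

open scoped Classical ENNReal

/-! ### Expectations and running times of programs -/

namespace Prog

variable {α β : Type*}

theorem tsum_sum_antidiagonal (F : ℕ → ℕ → ℝ≥0∞) :
    ∑' t, ∑ st ∈ Finset.HasAntidiagonal.antidiagonal t, F st.1 st.2 = ∑' s, ∑' u, F s u := by
  rw [← ENNReal.tsum_prod,
    ← Finset.HasAntidiagonal.sigmaAntidiagonalEquivProd.tsum_eq (fun p : ℕ × ℕ => F p.1 p.2),
    ENNReal.tsum_sigma']
  refine tsum_congr fun t => ?_
  rw [tsum_fintype, Finset.univ_eq_attach]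
  exact (Finset.sum_attach _ (fun st : ℕ × ℕ => F st.1 st.2)).symm

/-- Integrating a function of output and running time over a sequential composition: first over the
runs of the first program, then over those of the second, with the running times added. -/
theorem tsum_bind (p : Prog α) (q : α → Prog β) (h : β × ℕ → ℝ≥0∞) :
    ∑' y, p.bind q y * h y = ∑' x, p x * ∑' z, q x.1 z * h (z.1, x.2 + z.2) := by
  have key : ∀ (a : α) (b : β), ∑' t, (∑ st ∈ Finset.HasAntidiagonal.antidiagonal t,
      p (a, st.1) * q a (b, st.2)) * h (b, t) =
      ∑' s, ∑' u, p (a, s) * (q a (b, u) * h (b, s + u)) := by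
    intro a b
    rw [← tsum_sum_antidiagonal fun s u => p (a, s) * (q a (b, u) * h (b, s + u))]
    refine tsum_congr fun t => ?_
    rw [Finset.sum_mul]
    refine Finset.sum_congr rfl fun st hst => ?_
    rw [Finset.HasAntidiagonal.mem_antidiagonal.1 hst, mul_assoc]
  calc ∑' y, p.bind q y * h y
      = ∑' b, ∑' t, ∑' a, (∑ st ∈ Finset.HasAntidiagonal.antidiagonal t,
          p (a, st.1) * q a (b, st.2)) * h (b, t) := by
        rw [ENNReal.tsum_prod']
        exact tsum_congr fun b => tsum_congr fun t => ENNReal.tsum_mul_right.symm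
    _ = ∑' b, ∑' a, ∑' s, ∑' u, p (a, s) * (q a (b, u) * h (b, s + u)) := by
        refine tsum_congr fun b => ?_
        rw [ENNReal.tsum_comm]
        exact tsum_congr fun a => key a b
    _ = ∑' a, ∑' s, ∑' b, ∑' u, p (a, s) * (q a (b, u) * h (b, s + u)) := by
        rw [ENNReal.tsum_comm]
        exact tsum_congr fun a => ENNReal.tsum_comm
    _ = ∑' x, p x * ∑' z, q x.1 z * h (z.1, x.2 + z.2) := by
        rw [ENNReal.tsum_prod']
        refine tsum_congr fun a => tsum_congr fun s => ?_
        rw [ENNReal.tsum_prod', ← ENNReal.tsum_mul_left]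
        exact tsum_congr fun b => by rw [← ENNReal.tsum_mul_left]

/-- The expectation of `g` at the output, over the runs that stop. -/
noncomputable def expect (p : Prog α) (g : α → ℝ≥0∞) : ℝ≥0∞ := ∑' x, p x * g x.1

theorem expect_one (p : Prog α) : p.expect (fun _ => 1) = p.haltProb := by
  simp [expect, haltProb]

theorem expect_bind (p : Prog α) (q : α → Prog β) (g : β → ℝ≥0∞) :
    (p.bind q).expect g = p.expect fun a => (q a).expect g :=
  tsum_bind p q fun y => g y.1

theorem haltProb_bind (p : Prog α) (q : α → Prog β) :
    (p.bind q).haltProb = p.expect fun a => (q a).haltProb := by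
  simp only [← expect_one, expect_bind]

theorem expectedTime_bind (p : Prog α) (q : α → Prog β) :
    (p.bind q).expectedTime =
      ∑' x, p x * ((x.2 : ℝ≥0∞) * (q x.1).haltProb + (q x.1).expectedTime) := by
  unfold expectedTime
  rw [tsum_bind]
  refine tsum_congr fun x => ?_
  congr 1
  rw [haltProb, ← ENNReal.tsum_mul_left, ← ENNReal.tsum_add]
  refine tsum_congr fun z => ?_
  push_cast
  ring

theorem expect_mono (p : Prog α) {g g' : α → ℝ≥0∞} (h : ∀ a, g a ≤ g' a) :
    p.expect g ≤ p.expect g' :=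
  ENNReal.tsum_le_tsum fun x => by gcongr; exact h _

theorem expect_const (p : Prog α) (c : ℝ≥0∞) : p.expect (fun _ => c) = p.haltProb * c :=
  ENNReal.tsum_mul_right

theorem expect_ret (a : α) (g : α → ℝ≥0∞) : (ret a).expect g = g a := by
  unfold expect
  rw [tsum_eq_single (a, 0)]
  · simp [ret]
  · intro x hx
    simp [ret, hx]

theorem haltProb_ret (a : α) : (ret a).haltProb = 1 := by
  rw [← expect_one, expect_ret]

theorem expectedTime_ret (a : α) : (ret a).expectedTime = 0 := by
  unfold expectedTime
  refine ENNReal.tsum_eq_zero.2 fun x => ?_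
  by_cases h : x = (a, 0)
  · simp [h]
  · simp [ret, h]

theorem haltProb_fail : (fail : Prog α).haltProb = 0 := by simp [haltProb, fail]

theorem expectedTime_fail : (fail : Prog α).expectedTime = 0 := by simp [expectedTime, fail]

/-- The program stops with probability one, in expected time at most `B`. -/
def RunsIn (p : Prog α) (B : ℝ≥0∞) : Prop := p.haltProb = 1 ∧ p.expectedTime ≤ B

theorem RunsIn.mono {p : Prog α} {B B' : ℝ≥0∞} (h : p.RunsIn B) (hB : B ≤ B') : p.RunsIn B' :=
  ⟨h.1, h.2.trans hB⟩

theorem RunsIn.bind {p : Prog α} {q : α → Prog β} {B B' : ℝ≥0∞} (hp : p.RunsIn B)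
    (hq : ∀ a, (q a).RunsIn B') : (p.bind q).RunsIn (B + B') := by
  constructor
  · rw [haltProb_bind]
    simp only [(hq _).1, expect_one, hp.1]
  · rw [expectedTime_bind]
    calc ∑' x, p x * ((x.2 : ℝ≥0∞) * (q x.1).haltProb + (q x.1).expectedTime)
        ≤ ∑' x, (p x * (x.2 : ℝ≥0∞) + p x * B') := by
          refine ENNReal.tsum_le_tsum fun x => ?_
          rw [(hq _).1, mul_one, mul_add]
          gcongr
          exact (hq _).2
      _ = p.expectedTime + B' := by
          rw [ENNReal.tsum_add, ENNReal.tsum_mul_right]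
          change p.expectedTime + p.haltProb * B' = _
          rw [hp.1, one_mul]
      _ ≤ B + B' := by gcongr; exact hp.2

theorem RunsIn.ret (a : α) : (ret a).RunsIn 0 := ⟨haltProb_ret a, (expectedTime_ret a).le⟩

/-- A program that takes exactly `n` time units runs in time `n` if its weights sum to one. -/
theorem RunsIn.of_time_eq {p : Prog α} {n : ℕ} {w : α → ℝ≥0∞}
    (hp : ∀ x, p x = if x.2 = n then w x.1 else 0) (hw : ∑' a, w a = 1) : p.RunsIn n := by
  have key : ∀ c : ℕ → ℝ≥0∞, ∑' x, p x * c x.2 = c n := by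
    intro c
    rw [ENNReal.tsum_prod']
    have : ∀ a, ∑' t, p (a, t) * c t = w a * c n := by
      intro a
      rw [tsum_eq_single n]
      · simp [hp]
      · intro t ht
        simp [hp, ht]
    simp only [this]
    rw [ENNReal.tsum_mul_right, hw, one_mul]
  exact ⟨by simpa [haltProb] using key fun _ => 1, (key fun t => (t : ℝ≥0∞)).le⟩

theorem RunsIn.spend (n : ℕ) : (spend n).RunsIn n :=
  RunsIn.of_time_eq (w := fun _ => 1) (fun x => by simp [Prog.spend]) (by simp)

theorem RunsIn.draw [Fintype α] {w : α → ℕ} (hw : ∃ a, w a ≠ 0) : (draw w).RunsIn 1 := by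
  have := RunsIn.of_time_eq (p := Prog.draw w) (n := 1)
    (w := fun a => (w a : ℝ≥0∞) / ∑ a, (w a : ℝ≥0∞)) (fun x => rfl) ?_
  · simpa using this
  · rw [tsum_fintype]
    simp only [div_eq_mul_inv]
    rw [← Finset.sum_mul]
    refine ENNReal.mul_inv_cancel ?_ ?_
    · obtain ⟨a, ha⟩ := hw
      intro h
      exact ha (by simpa using Finset.sum_eq_zero_iff.1 h a (Finset.mem_univ a))
    · exact (ENNReal.sum_lt_top.2 fun a _ => ENNReal.natCast_lt_top _).ne

theorem RunsIn.flip (p : ℚ) : (flip p).RunsIn 1 := by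
  have := RunsIn.of_time_eq (p := Prog.flip p) (n := 1)
    (w := fun b => if b then ENNReal.ofReal (min (p : ℝ) 1)
      else 1 - ENNReal.ofReal (min (p : ℝ) 1)) (fun x => rfl) ?_
  · simpa using this
  · rw [tsum_fintype, Fintype.sum_bool]
    simp only [if_true, Bool.false_eq_true, if_false]
    exact add_tsub_cancel_of_le (ENNReal.ofReal_le_one.2 (min_le_right _ _))

theorem le_expect_flip (p : ℚ) (g : Bool → ℝ≥0∞) :
    ENNReal.ofReal (min (p : ℝ) 1) * g true ≤ (Prog.flip p).expect g := by
  refine le_trans (le_of_eq ?_) (ENNReal.le_tsum (true, 1))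
  simp [Prog.flip]

theorem RunsIn.iterate {body : α → Prog α} {B : ℝ≥0∞} (h : ∀ a, (body a).RunsIn B) (n : ℕ)
    (a : α) : (iterate body n a).RunsIn (n * B) := by
  induction n generalizing a with
  | zero => simpa [Prog.iterate] using RunsIn.ret a
  | succ n ih =>
    refine ((h a).bind fun b => ih b).mono (le_of_eq ?_)
    push_cast
    ring

/-- Wald's bound for rejection sampling: if a round takes expected time at most `B` and is
successful with probability at least `s`, the expected time until the first success is at most
`s⁻¹ * B`. -/
theorem RunsIn.repeatUntil {body : Prog (Option α)} {B s : ℝ≥0∞} (h : body.RunsIn B) (hs : s ≠ 0)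
    (hsome : s ≤ body.expect fun o => o.elim 0 fun _ => 1) :
    (repeatUntil body).RunsIn (s⁻¹ * B) := by
  set σ := body.expect fun o => o.elim 0 fun _ => 1 with hσ
  set q := body.expect fun o => o.elim 1 fun _ => 0 with hq
  have hadd : σ + q = 1 := by
    rw [← h.1, ← expect_one, hσ, hq]
    unfold expect
    rw [← ENNReal.tsum_add]
    refine tsum_congr fun x => ?_
    rcases x.1 with _ | a <;> simp
  have hσ0 : σ ≠ 0 := fun h0 => hs (le_antisymm (h0 ▸ hsome) zero_le)
  have hσ1 : σ ≤ 1 := hadd ▸ le_self_add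
  have hσt : σ ≠ ∞ := ne_top_of_le_ne_top ENNReal.one_ne_top hσ1
  have hqt : q ≠ ∞ := ne_top_of_le_ne_top ENNReal.one_ne_top (hadd ▸ le_add_self)
  have h1q : 1 - q = σ := by rw [← hadd]; exact ENNReal.add_sub_cancel_right hqt
  have hinv : 1 + q * σ⁻¹ = σ⁻¹ := by
    rw [← ENNReal.mul_inv_cancel hσ0 hσt, ← add_mul, hadd, one_mul]
  have hmass : ∀ n, (rounds body n).haltProb = q ^ n * σ := by
    intro n
    induction n with
    | zero =>
      rw [rounds, haltProb_bind, pow_zero, one_mul, hσ]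
      congr 1
      funext o
      rcases o with _ | a
      · exact haltProb_fail
      · exact haltProb_ret a
    | succ n ih =>
      rw [rounds, haltProb_bind, pow_succ', mul_assoc, ← ih, hq]
      unfold expect
      rw [← ENNReal.tsum_mul_right]
      refine tsum_congr fun x => ?_
      rcases x.1 with _ | a
      · simp
      · simp [haltProb_fail]
  have hone : ∑' n, q ^ n * σ = 1 := by
    rw [ENNReal.tsum_mul_right, ENNReal.tsum_geometric, h1q, ENNReal.inv_mul_cancel hσ0 hσt]
  -- The first `N + 1` terms are the time of a first round plus, if it fails, the first `N` terms
  -- for the rounds that follow; with partial sums the total need not be known to be finite.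
  have hpart : ∀ N, ∑ n ∈ Finset.range N, (rounds body n).expectedTime ≤ σ⁻¹ * B := by
    intro N
    induction N with
    | zero => simp
    | succ N ih =>
      have hle : ∑ n ∈ Finset.range N, (rounds body n).haltProb ≤ 1 := by
        simp only [hmass]
        exact (ENNReal.sum_le_tsum _).trans hone.le
      have hstep : ∑ n ∈ Finset.range (N + 1), (rounds body n).expectedTime =
          ∑' x, body x * x.1.elim (∑ n ∈ Finset.range N,
            ((x.2 : ℝ≥0∞) * (rounds body n).haltProb + (rounds body n).expectedTime))
            (fun _ => (x.2 : ℝ≥0∞)) := by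
        rw [Finset.sum_range_succ']
        simp only [rounds, expectedTime_bind]
        rw [← Summable.tsum_finsetSum fun _ _ => ENNReal.summable, ← ENNReal.tsum_add]
        refine tsum_congr fun x => ?_
        rw [← Finset.mul_sum, ← mul_add]
        rcases x.1 with _ | a
        · simp [haltProb_fail, expectedTime_fail]
        · simp [haltProb_fail, expectedTime_fail, haltProb_ret, expectedTime_ret]
      rw [hstep]
      calc _ ≤ ∑' x, (body x * (x.2 : ℝ≥0∞) +
            (body x * x.1.elim 1 fun _ => 0) * (σ⁻¹ * B)) := by
            refine ENNReal.tsum_le_tsum fun x => ?_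
            rw [mul_assoc, ← mul_add]
            gcongr
            rcases x.1 with _ | a
            · simp only [Option.elim, one_mul]
              rw [Finset.sum_add_distrib, ← Finset.mul_sum]
              gcongr
              exact mul_le_of_le_one_right' hle
            · simp
        _ = body.expectedTime + q * (σ⁻¹ * B) := by
            rw [ENNReal.tsum_add, ENNReal.tsum_mul_right]
            rfl
        _ ≤ B + q * (σ⁻¹ * B) := by gcongr; exact h.2
        _ = (1 + q * σ⁻¹) * B := by ring
        _ = σ⁻¹ * B := by rw [hinv]
  constructor
  · unfold haltProb Prog.repeatUntil
    rw [ENNReal.tsum_comm, ← hone]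
    exact tsum_congr fun n => hmass n
  · refine le_trans ?_ (mul_le_mul_left (ENNReal.inv_le_inv.2 hsome) B)
    have : (Prog.repeatUntil body).expectedTime = ∑' n, (rounds body n).expectedTime := by
      unfold expectedTime Prog.repeatUntil
      simp only [← ENNReal.tsum_mul_right]
      exact ENNReal.tsum_comm
    rw [this, ENNReal.tsum_eq_iSup_nat]
    exact iSup_le hpart

end Prog

/-! ### Growing connected vertex sets -/

variable {V : Type*}

theorem exists_adj_of_ssubset {G : SimpleGraph V} {C S : Finset V}
    (hS : (G.induce (S : Set V)).Connected) (hC : C.Nonempty) (hCS : C ⊂ S) :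
    ∃ y ∈ C, ∃ x ∈ S, x ∉ C ∧ G.Adj y x := by
  obtain ⟨y, hy⟩ := hC
  obtain ⟨x, hxS, hxC⟩ := Finset.exists_of_ssubset hCS
  obtain ⟨p⟩ := hS.preconnected ⟨y, hCS.1 hy⟩ ⟨x, hxS⟩
  obtain ⟨d, -, h1, h2⟩ := p.exists_boundary_dart {z | z.1 ∈ C} hy hxC
  exact ⟨d.fst.1, h1, d.snd.1, d.snd.2, h2, d.adj⟩

theorem connected_induce_insert {G : SimpleGraph V} {C : Finset V} {x y : V}
    (hC : (G.induce (C : Set V)).Connected) (hy : y ∈ C) (h : G.Adj y x) :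
    (G.induce ((insert x C : Finset V) : Set V)).Connected := by
  have heq : ((insert x C : Finset V) : Set V) = {y, x} ∪ (C : Set V) := by
    ext z
    simp only [Finset.coe_insert, Set.mem_insert_iff, Finset.mem_coe, Set.mem_union,
      Set.mem_singleton_iff]
    constructor
    · tauto
    · rintro ((rfl | h) | h)
      · exact Or.inr hy
      · exact Or.inl h
      · exact Or.inr h
  rw [heq]
  exact SimpleGraph.induce_union_connected
    (SimpleGraph.induce_pair_connected_of_adj h).preconnected hC.preconnected ⟨y, by simp, hy⟩

/-- Between two nested connected sets there is a connected set of every intermediate size. -/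
theorem exists_connected_between {G : SimpleGraph V} {C S : Finset V}
    (hC : (G.induce (C : Set V)).Connected) (hS : (G.induce (S : Set V)).Connected) (hCS : C ⊆ S)
    {m : ℕ} (h1 : C.card ≤ m) (h2 : m ≤ S.card) :
    ∃ D, C ⊆ D ∧ D ⊆ S ∧ D.card = m ∧ (G.induce (D : Set V)).Connected := by
  induction m, h1 using Nat.le_induction with
  | base => exact ⟨C, subset_rfl, hCS, rfl, hC⟩
  | succ m hm ih =>
    obtain ⟨D, hCD, hDS, hcard, hD⟩ := ih (by omega)
    have hss : D ⊂ S := by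
      refine hDS.ssubset_of_ne fun h => ?_
      rw [h] at hcard
      omega
    have hne : D.Nonempty := by
      obtain ⟨x⟩ := hD.nonempty
      exact ⟨x.1, x.2⟩
    obtain ⟨y, hy, x, hxS, hxD, hadj⟩ := exists_adj_of_ssubset hS hne hss
    refine ⟨insert x D, hCD.trans (Finset.subset_insert _ _), Finset.insert_subset hxS hDS, ?_,
      connected_induce_insert hD hy hadj⟩
    rw [Finset.card_insert_of_notMem hxD, hcard]

theorem connected_induce_singleton (G : SimpleGraph V) (x : V) :
    (G.induce (({x} : Finset V) : Set V)).Connected := by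
  rw [Finset.coe_singleton]
  have : Subsingleton (({x} : Set V)) := by infer_instance
  have : Nonempty (({x} : Set V)) := ⟨⟨x, rfl⟩⟩
  exact ⟨SimpleGraph.Preconnected.of_subsingleton⟩

theorem exists_connected_erase {G : SimpleGraph V} {k : ℕ} (H : KSub G (k + 2)) {w : V}
    (hw : w ∈ H.1) : ∃ F : KSub G (k + 1), F.1 ⊆ H.1 ∧ w ∈ F.1 := by
  obtain ⟨D, h1, h2, h3, h4⟩ := exists_connected_between (connected_induce_singleton G w) H.2.2
    (Finset.singleton_subset_iff.2 hw) (m := k + 1) (by simp) (by rw [H.2.1]; omega)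
  exact ⟨⟨D, h3, h4⟩, h2, by simpa using h1⟩

variable [Fintype V]

theorem connected_induce_univ {G : SimpleGraph V} (hG : G.Connected) :
    (G.induce ((Finset.univ : Finset V) : Set V)).Connected := by
  rw [Finset.coe_univ]
  exact (SimpleGraph.induceUnivIso G).connected_iff.2 hG

/-! ### Degrees and subgraph numbers of connected `k`-subgraphs -/

variable {G : SimpleGraph V}

/-- A connected set keeps connected when a suitable node is removed, and that node may be chosen
outside any given node; so there are at least two such nodes. -/
theorem two_le_numSub {k : ℕ} (H : KSub G (k + 2)) : 2 ≤ numSub G H := by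
  have hne : H.1.Nonempty := by rw [← Finset.card_pos, H.2.1]; omega
  obtain ⟨w, hw⟩ := hne
  obtain ⟨F, hFH, -⟩ := exists_connected_erase H hw
  have hlt : F.1.card < H.1.card := by rw [F.2.1, H.2.1]; omega
  obtain ⟨v, hvH, hvF⟩ := Finset.exists_mem_notMem_of_card_lt_card hlt
  obtain ⟨F', hFH', hv⟩ := exists_connected_erase H hvH
  refine Finset.one_lt_card.2 ⟨F, by simpa using hFH, F', by simpa using hFH', ?_⟩
  rintro rfl
  exact hvF hv

theorem numSub_le {k : ℕ} (H : KSub G (k + 1)) : numSub G H ≤ k + 1 := by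
  have : numSub G H ≤ (H.1.powersetCard k).card := by
    refine Finset.card_le_card_of_injOn (fun F => F.1) ?_ Subtype.val_injective.injOn
    intro F hF
    simp only [Finset.coe_filter, Finset.mem_univ, true_and, Set.mem_ofPred_eq] at hF
    exact Finset.mem_coe.2 (Finset.mem_powersetCard.2 ⟨hF, F.2.1⟩)
  rwa [Finset.card_powersetCard, H.2.1, Nat.choose_succ_self_right] at this

/-- Add to `H` an adjacent node `x`, and remove another node so that the set stays connected. -/
theorem stateDeg_pos (hG : G.Connected) {k : ℕ} (hk : 1 ≤ k) (hkV : k < Fintype.card V)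
    (H : KSub G k) : 0 < stateDeg G H := by
  have hne : H.1.Nonempty := by rw [← Finset.card_pos, H.2.1]; omega
  have hss : H.1 ⊂ Finset.univ := by
    refine (Finset.subset_univ _).ssubset_of_ne fun h => ?_
    have := H.2.1
    rw [h, Finset.card_univ] at this
    omega
  obtain ⟨y, hy, x, -, hx, hadj⟩ := exists_adj_of_ssubset (connected_induce_univ hG) hne hss
  have hc : (insert x H.1).card = k + 1 := by rw [Finset.card_insert_of_notMem hx, H.2.1]
  obtain ⟨D, h1, h2, h3, h4⟩ := exists_connected_between (connected_induce_singleton G x)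
    (connected_induce_insert H.2.2 hy hadj) (Finset.singleton_subset_iff.2 (by simp)) (m := k)
    (by simpa using hk) (by omega)
  have hxD : x ∈ D := by simpa using h1
  unfold stateDeg
  rw [SimpleGraph.degree_pos_iff_exists_adj]
  refine ⟨⟨D, h3, h4⟩, ?_⟩
  have : H.1 ∩ D = D.erase x := by
    ext z
    simp only [Finset.mem_inter, Finset.mem_erase]
    constructor
    · rintro ⟨hz, hz'⟩
      exact ⟨fun h => hx (h ▸ hz), hz'⟩
    · rintro ⟨hz, hz'⟩
      exact ⟨(Finset.mem_insert.1 (h2 hz')).resolve_left hz, hz'⟩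
  change (H.1 ∩ D).card + 1 = k
  rw [this, Finset.card_erase_of_mem hxD, h3]
  omega

/-- A neighbour of `H` arises by exchanging one of the `k` nodes of `H` for a node adjacent
to `H`. -/
theorem stateDeg_le {k : ℕ} (hk : 2 ≤ k) (H : KSub G k) : stateDeg G H ≤ k * (k * maxDeg G) := by
  have hsub : ((stateGraph G k).neighborFinset H).image (fun F => F.1) ⊆
      (H.1 ×ˢ H.1.biUnion fun u => G.neighborFinset u).image
        fun vw => insert vw.2 (H.1.erase vw.1) := by
    intro S hS
    obtain ⟨F, hF, rfl⟩ := Finset.mem_image.1 hS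
    have hadj : (H.1 ∩ F.1).card + 1 = k := by
      rw [SimpleGraph.mem_neighborFinset] at hF
      exact hF
    have h1 : (H.1 \ F.1).card = 1 := by
      have := Finset.card_sdiff_add_card_inter H.1 F.1
      rw [H.2.1] at this
      omega
    have h2 : (F.1 \ H.1).card = 1 := by
      have := Finset.card_sdiff_add_card_inter F.1 H.1
      rw [F.2.1, Finset.inter_comm] at this
      omega
    obtain ⟨v, hv⟩ := Finset.card_eq_one.1 h1
    obtain ⟨w, hw⟩ := Finset.card_eq_one.1 h2
    have hv' : ∀ z, (z ∈ H.1 ∧ z ∉ F.1) ↔ z = v := fun z => by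
      rw [← Finset.mem_sdiff, hv, Finset.mem_singleton]
    have hw' : ∀ z, (z ∈ F.1 ∧ z ∉ H.1) ↔ z = w := fun z => by
      rw [← Finset.mem_sdiff, hw, Finset.mem_singleton]
    have hwF := (hw' w).2 rfl
    have hss : {w} ⊂ F.1 := by
      refine (Finset.singleton_subset_iff.2 hwF.1).ssubset_of_ne fun h => ?_
      have := F.2.1
      rw [← h, Finset.card_singleton] at this
      omega
    obtain ⟨y, hy, x, hxF, hxw, hyx⟩ := exists_adj_of_ssubset F.2.2 ⟨w, by simp⟩ hss
    rw [Finset.mem_singleton] at hy hxw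
    subst hy
    have hxH : x ∈ H.1 := by
      by_contra hx
      exact hxw ((hw' x).1 ⟨hxF, hx⟩)
    refine Finset.mem_image.2 ⟨(v, y), Finset.mem_product.2 ⟨((hv' v).2 rfl).1,
      Finset.mem_biUnion.2 ⟨x, hxH, by simpa using hyx.symm⟩⟩, ?_⟩
    ext z
    simp only [Finset.mem_insert, Finset.mem_erase, ne_eq, ← hv' z, ← hw' z]
    by_cases h3 : z ∈ H.1 <;> by_cases h4 : z ∈ F.1 <;> simp [h3, h4]
  have h1 := Finset.card_le_card hsub
  rw [Finset.card_image_of_injective _ Subtype.val_injective,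
    SimpleGraph.card_neighborFinset_eq_degree] at h1
  refine h1.trans (Finset.card_image_le.trans ?_)
  rw [Finset.card_product, H.2.1]
  refine Nat.mul_le_mul_left k ?_
  have h2 := Finset.card_biUnion_le_card_mul H.1 (fun u => G.neighborFinset u) (maxDeg G)
    fun u _ => (SimpleGraph.card_neighborFinset_eq_degree G u).le.trans (G.degree_le_maxDegree u)
  rwa [H.2.1] at h2

theorem one_le_choose_numSub {k : ℕ} (H : KSub G (k + 2)) : 1 ≤ (numSub G H).choose 2 :=
  Nat.choose_pos (two_le_numSub H)

theorem weight_pos (hG : G.Connected) {k : ℕ} (hkV : k + 2 < Fintype.card V)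
    (H : KSub G (k + 2)) : 0 < weight G H := by
  unfold weight
  have h1 := stateDeg_pos hG (by omega) hkV H
  have h2 := one_le_choose_numSub H
  have : (0 : ℚ) < (numSub G H).choose 2 := by exact_mod_cast h2
  have : (0 : ℚ) < stateDeg G H := by exact_mod_cast h1
  positivity

/-- The maximum of `f`: the degree is at most `j * (j * Δ)`, and the denominator is at least one. -/
theorem weight_le {k : ℕ} (H : KSub G (k + 2)) :
    weight G H ≤ ((k + 2 : ℕ) : ℚ) ^ 2 * maxDeg G := by
  unfold weight
  have h1 : (stateDeg G H : ℚ) ≤ ((k + 2 : ℕ) : ℚ) * (((k + 2 : ℕ) : ℚ) * maxDeg G) := by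
    exact_mod_cast stateDeg_le (by omega) H
  have h2 : (1 : ℚ) ≤ (numSub G H).choose 2 := by exact_mod_cast one_le_choose_numSub H
  calc _ ≤ (stateDeg G H : ℚ) := div_le_self (by positivity) h2
    _ ≤ _ := h1
    _ = _ := by ring

/-! ### Counting the edges of the state graphs -/

variable (G) in
/-- The connected `(n+2)`-subgraphs of an `(n+3)`-subgraph. -/
noncomputable def subs {n : ℕ} (H : KSub G (n + 3)) : Finset (KSub G (n + 2)) :=
  Finset.univ.filter fun F => F.1 ⊆ H.1

theorem mem_subs {n : ℕ} {H : KSub G (n + 3)} {F : KSub G (n + 2)} :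
    F ∈ subs G H ↔ F.1 ⊆ H.1 := by simp [subs]

theorem card_subs {n : ℕ} (H : KSub G (n + 3)) : (subs G H).card = numSub G H := rfl

theorem edgeUnion_mk {n : ℕ} (F F' : KSub G (n + 2))
    (h : s(F, F') ∈ (stateGraph G (n + 2)).edgeSet) :
    (edgeUnion G ⟨s(F, F'), h⟩).1 = F.1 ∪ F'.1 := by
  ext x
  simp [edgeUnion]

/-- Any two distinct connected `(n+2)`-subgraphs of `H` are adjacent with union `H`. -/
theorem choose_le_card_fiber {n : ℕ} (H : KSub G (n + 3)) :
    (numSub G H).choose 2 ≤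
      (Finset.univ.filter fun e : StateEdge G (n + 2) => edgeUnion G e = H).card := by
  rw [← card_subs, ← Sym2.card_image_offDiag,
    ← Finset.card_image_of_injective (Finset.univ.filter _)
      (Subtype.val_injective (p := (· ∈ (stateGraph G (n + 2)).edgeSet)))]
  refine Finset.card_le_card fun e he => ?_
  obtain ⟨⟨F, F'⟩, hF, rfl⟩ := Finset.mem_image.1 he
  obtain ⟨h1, h2, hne⟩ := Finset.mem_offDiag.1 hF
  rw [mem_subs] at h1 h2
  simp only at h1 h2 hne
  have hsub : F.1 ∪ F'.1 ⊆ H.1 := Finset.union_subset h1 h2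
  have hlt : F.1.card < (F.1 ∪ F'.1).card := by
    refine Finset.card_lt_card (Finset.subset_union_left.ssubset_of_ne fun h => hne ?_)
    refine Subtype.ext (Finset.eq_of_subset_of_card_le (h ▸ Finset.subset_union_right) ?_).symm
    rw [F.2.1, F'.2.1]
  have hle := Finset.card_le_card hsub
  have hui := Finset.card_union_add_card_inter F.1 F'.1
  have hc := F.2.1
  have hc' := F'.2.1
  have hH := H.2.1
  have hadj : s(F, F') ∈ (stateGraph G (n + 2)).edgeSet := by
    change (F.1 ∩ F'.1).card + 1 = n + 2
    omega
  refine Finset.mem_image.2 ⟨⟨s(F, F'), hadj⟩, ?_, rfl⟩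
  rw [Finset.mem_filter]
  refine ⟨Finset.mem_univ _, Subtype.ext ?_⟩
  rw [edgeUnion_mk]
  exact Finset.eq_of_subset_of_card_le hsub (by omega)

/-- An edge with union `H` is an unordered pair of connected `(n+2)`-subgraphs of `H`. -/
theorem card_fiber_le {n : ℕ} (H : KSub G (n + 3)) :
    (Finset.univ.filter fun e : StateEdge G (n + 2) => edgeUnion G e = H).card ≤ (n + 3) ^ 2 := by
  have h1 : (Finset.univ.filter fun e : StateEdge G (n + 2) => edgeUnion G e = H).card ≤
      (subs G H).sym2.card := by
    refine Finset.card_le_card_of_injOn (fun e => e.1) ?_ Subtype.val_injective.injOn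
    rintro ⟨e, he⟩ h
    simp only [Finset.coe_filter, Finset.mem_univ, true_and, Set.mem_ofPred_eq] at h
    rw [Finset.mem_coe, Finset.mem_sym2_iff]
    intro F hF
    rw [mem_subs, ← h]
    intro x hx
    simp only [edgeUnion, Finset.mem_filter, Finset.mem_univ, true_and]
    exact ⟨F, hF, hx⟩
  rw [Finset.card_sym2, card_subs] at h1
  refine h1.trans ((Nat.choose_le_choose 2 (Nat.succ_le_succ (numSub_le H))).trans ?_)
  rw [Nat.choose_two_right]
  refine Nat.div_le_of_le_mul ?_
  simp only [Nat.succ_eq_add_one, Nat.add_sub_cancel]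
  nlinarith

theorem card_stateEdge_le (n : ℕ) :
    Fintype.card (StateEdge G (n + 2)) ≤ (n + 3) ^ 2 * Fintype.card (KSub G (n + 3)) := by
  rw [← Finset.card_univ, ← Finset.card_univ]
  exact Finset.card_le_mul_card_image_of_maps_to (f := edgeUnion G) (fun _ _ => Finset.mem_univ _)
    _ fun H _ => card_fiber_le H

theorem card_kSub_pos (hG : G.Connected) {j : ℕ} (hj : 1 ≤ j) (hjV : j ≤ Fintype.card V) :
    0 < Fintype.card (KSub G j) := by
  obtain ⟨x⟩ := hG.nonempty
  obtain ⟨D, -, -, h3, h4⟩ := exists_connected_between (connected_induce_singleton G x)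
    (connected_induce_univ hG) (Finset.subset_univ _) (m := j) (by simpa using hj)
    (by simpa using hjV)
  exact Fintype.card_pos_iff.2 ⟨⟨D, h3, h4⟩⟩

/-- Every connected `i`-subgraph extends to a connected `j`-subgraph, and a `j`-subgraph has at most
`2 ^ j` subsets. -/
theorem card_kSub_le (hG : G.Connected) {i j : ℕ} (hij : i ≤ j)
    (hjV : j ≤ Fintype.card V) : Fintype.card (KSub G i) ≤ 2 ^ j * Fintype.card (KSub G j) := by
  have hext : ∀ H : KSub G i, ∃ F : KSub G j, H.1 ⊆ F.1 := by
    intro H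
    obtain ⟨D, h1, -, h3, h4⟩ := exists_connected_between H.2.2
      (connected_induce_univ hG) (Finset.subset_univ _) (m := j) (by rwa [H.2.1])
      (by simpa using hjV)
    exact ⟨⟨D, h3, h4⟩, h1⟩
  choose φ hφ using hext
  rw [← Finset.card_univ, ← Finset.card_univ]
  refine Finset.card_le_mul_card_image_of_maps_to (f := φ) (fun _ _ => Finset.mem_univ _)
    _ fun F _ => ?_
  calc _ ≤ F.1.powerset.card := by
        refine Finset.card_le_card_of_injOn (fun H => H.1) ?_ Subtype.val_injective.injOn
        intro H hH
        simp only [Finset.coe_filter, Finset.mem_univ, true_and, Set.mem_ofPred_eq] at hH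
        exact Finset.mem_coe.2 (Finset.mem_powerset.2 (hH ▸ hφ H))
    _ = 2 ^ j := by rw [Finset.card_powerset, F.2.1]

theorem sum_stateDeg (j : ℕ) :
    ∑ H : KSub G j, stateDeg G H = 2 * Fintype.card (StateEdge G j) := by
  have := (stateGraph G j).sum_degrees_eq_twice_card_edges
  rw [SimpleGraph.edgeFinset, Set.toFinset_card] at this
  exact this

theorem card_kSub_le_card_stateEdge (hG : G.Connected) {j : ℕ} (hj : 1 ≤ j)
    (hjV : j < Fintype.card V) :
    Fintype.card (KSub G j) ≤ 2 * Fintype.card (StateEdge G j) := by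
  rw [← sum_stateDeg, ← Finset.card_univ, Finset.card_eq_sum_ones]
  exact Finset.sum_le_sum fun H _ => stateDeg_pos hG hj hjV H

theorem card_stateEdge_pos (hG : G.Connected) {j : ℕ} (hj : 1 ≤ j) (hjV : j < Fintype.card V) :
    0 < Fintype.card (StateEdge G j) := by
  have := card_kSub_pos hG hj hjV.le
  have := card_kSub_le_card_stateEdge hG hj hjV
  omega

/-- Edge numbers of state graphs of different levels: going down from level `j` to level `i`, the
number of edges grows at most by a factor exponential in `j`. Up to factors polynomial in `j`,
there are at most as many edges of level `i` as connected `(i+1)`-subgraphs and at least as many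
edges of level `j` as connected `j`-subgraphs; each of the former lies in one of the latter, and
each of the latter contains at most `2 ^ j` of the former. -/
theorem card_stateEdge_le_of_le (hG : G.Connected) {i j : ℕ} (hi : 2 ≤ i) (hij : i ≤ j)
    (hjV : j < Fintype.card V) :
    Fintype.card (StateEdge G i) ≤ 8 ^ (j + 1) * Fintype.card (StateEdge G j) := by
  rcases hij.eq_or_lt with rfl | hlt
  · exact Nat.le_mul_of_pos_left _ (by positivity)
  · obtain ⟨n, rfl⟩ := Nat.exists_eq_add_of_le' hi
    have h1 := card_stateEdge_le (G := G) n
    have h2 := card_kSub_le hG (i := n + 3) (j := j) (by omega) hjV.le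
    have h3 := card_kSub_le_card_stateEdge hG (j := j) (by omega) hjV
    have h4 : (n + 3) ^ 2 ≤ 4 ^ j := by
      calc (n + 3) ^ 2 ≤ (2 ^ j) ^ 2 :=
            Nat.pow_le_pow_left ((by omega : n + 3 ≤ j).trans Nat.lt_two_pow_self.le) 2
        _ = 4 ^ j := by rw [← pow_mul, mul_comm, pow_mul]; norm_num
    calc _ ≤ (n + 3) ^ 2 * Fintype.card (KSub G (n + 3)) := h1
      _ ≤ 4 ^ j * (2 ^ j * (2 * Fintype.card (StateEdge G j))) :=
          Nat.mul_le_mul h4 (h2.trans (Nat.mul_le_mul_left _ h3))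
      _ = 2 * (4 * 2) ^ j * Fintype.card (StateEdge G j) := by rw [mul_pow]; ring
      _ ≤ 8 ^ (j + 1) * Fintype.card (StateEdge G j) := by
          rw [pow_succ']
          gcongr
          all_goals norm_num

/-- The sum of `f` over the edges of level `n + 2` is at least twice the number of edges of the
next level, by the handshaking lemma there. -/
theorem two_mul_card_le_sum_weight (n : ℕ) :
    2 * (Fintype.card (StateEdge G (n + 3)) : ℚ) ≤
      ∑ e : StateEdge G (n + 2), weight G (edgeUnion G e) := by
  have h := sum_stateDeg (G := G) (n + 3)
  have h' : (2 * (Fintype.card (StateEdge G (n + 3)) : ℚ)) =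
      ∑ H : KSub G (n + 3), (stateDeg G H : ℚ) := by exact_mod_cast h.symm
  rw [h', ← Finset.sum_fiberwise Finset.univ (edgeUnion G)]
  refine Finset.sum_le_sum fun H _ => ?_
  have hcard : ((numSub G H).choose 2 : ℚ) ≤
      (Finset.univ.filter fun e : StateEdge G (n + 2) => edgeUnion G e = H).card := by
    exact_mod_cast choose_le_card_fiber H
  have hpos : (0 : ℚ) < (numSub G H).choose 2 := by exact_mod_cast one_le_choose_numSub H
  have hsum : ∑ e ∈ Finset.univ.filter (fun e : StateEdge G (n + 2) => edgeUnion G e = H),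
      weight G (edgeUnion G e) =
      (Finset.univ.filter fun e : StateEdge G (n + 2) => edgeUnion G e = H).card * weight G H := by
    rw [Finset.sum_congr rfl (g := fun _ => weight G H), Finset.sum_const, nsmul_eq_mul]
    intro e he
    rw [(Finset.mem_filter.1 he).2]
  rw [hsum]
  calc (stateDeg G H : ℚ) = (numSub G H).choose 2 * weight G H := by
        unfold weight
        field_simp
    _ ≤ _ := by
        gcongr
        unfold weight
        positivity

/-! ### Mixing of chains with a Doeblin minorisation -/

section Doeblin

variable {Ω : Type*} [Fintype Ω] {P : Matrix Ω Ω ℝ} {π : Ω → ℝ} {β : ℝ}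

theorem row_sum_pow (hrow : ∀ x, ∑ y, P x y = 1) (l : ℕ) (x : Ω) : ∑ y, (P ^ l) x y = 1 := by
  induction l generalizing x with
  | zero => simp [Matrix.one_apply]
  | succ l ih =>
    simp only [pow_succ, Matrix.mul_apply]
    rw [Finset.sum_comm]
    simp only [← Finset.mul_sum, hrow, mul_one, ih]

/-- If every row of `P` dominates `β * π`, where `π` is stationary, then `P - β * π` is a
nonnegative kernel of total mass `1 - β` that acts like `P` on signed measures of mass zero, so each
step contracts the distance to `π` by `1 - β`. -/
theorem sum_abs_pow_sub_le (hmin : ∀ x y, β * π y ≤ P x y) (hrow : ∀ x, ∑ y, P x y = 1)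
    (hstat : ∀ y, ∑ x, π x * P x y = π y) (hπ : ∀ x, 0 ≤ π x) (hπ1 : ∑ x, π x = 1) (l : ℕ)
    (x : Ω) : ∑ y, |(P ^ l) x y - π y| ≤ 2 * (1 - β) ^ l := by
  have hrow' : ∀ z, ∑ y, |P z y - β * π y| = 1 - β := by
    intro z
    rw [Finset.sum_congr rfl fun y _ => abs_of_nonneg (sub_nonneg.2 (hmin z y)),
      Finset.sum_sub_distrib, hrow, ← Finset.mul_sum, hπ1, mul_one]
  have hβ : 0 ≤ 1 - β := by
    rw [← hrow' x]
    exact Finset.sum_nonneg fun _ _ => abs_nonneg _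
  induction l with
  | zero =>
    calc ∑ y, |(P ^ 0) x y - π y| ≤ ∑ y, ((if x = y then 1 else 0) + π y) := by
          refine Finset.sum_le_sum fun y _ => ?_
          rw [pow_zero, Matrix.one_apply]
          refine (abs_sub _ _).trans (le_of_eq ?_)
          rw [abs_of_nonneg (hπ y), abs_of_nonneg (by split_ifs <;> norm_num)]
      _ = 2 * (1 - β) ^ 0 := by
          rw [Finset.sum_add_distrib, hπ1, Finset.sum_ite_eq]
          norm_num
  | succ l ih =>
    have hzero : ∑ z, ((P ^ l) x z - π z) = 0 := by
      rw [Finset.sum_sub_distrib, row_sum_pow hrow, hπ1, sub_self]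
    have hstep : ∀ y, (P ^ (l + 1)) x y - π y =
        ∑ z, ((P ^ l) x z - π z) * (P z y - β * π y) := by
      intro y
      have : ∑ z, ((P ^ l) x z - π z) * (β * π y) = 0 := by
        rw [← Finset.sum_mul, hzero, zero_mul]
      simp only [mul_sub, Finset.sum_sub_distrib] at this ⊢
      rw [this, sub_zero, pow_succ, Matrix.mul_apply]
      simp only [sub_mul, Finset.sum_sub_distrib, hstat]
    calc ∑ y, |(P ^ (l + 1)) x y - π y|
        ≤ ∑ y, ∑ z, |(P ^ l) x z - π z| * |P z y - β * π y| := by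
          refine Finset.sum_le_sum fun y _ => ?_
          rw [hstep]
          refine (Finset.abs_sum_le_sum_abs _ _).trans (le_of_eq ?_)
          simp only [abs_mul]
      _ = (∑ z, |(P ^ l) x z - π z|) * (1 - β) := by
          rw [Finset.sum_comm, Finset.sum_mul]
          refine Finset.sum_congr rfl fun z _ => ?_
          rw [← Finset.mul_sum, hrow']
      _ ≤ 2 * (1 - β) ^ l * (1 - β) := by gcongr
      _ = 2 * (1 - β) ^ (l + 1) := by ring

theorem mixingTime_le_of_minorisation {ε a : ℝ} (hβ : 0 < β) (hmin : ∀ x y, β * π y ≤ P x y)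
    (hrow : ∀ x, ∑ y, P x y = 1) (hstat : ∀ y, ∑ x, π x * P x y = π y) (hπ : ∀ x, 0 ≤ π x)
    (hπ1 : ∑ x, π x = 1) (hε : Real.exp (-a) ≤ ε) : mixingTime P π ε ≤ ⌈a / β⌉₊ := by
  refine Finset.sup_le fun x _ => Nat.sInf_le fun l hl => ?_
  have h1 := sum_abs_pow_sub_le hmin hrow hstat hπ hπ1 l x
  have hβ1 : 0 ≤ 1 - β := by
    have := Finset.sum_le_sum fun y (_ : y ∈ Finset.univ) => hmin x y
    rw [hrow, ← Finset.mul_sum, hπ1] at this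
    linarith
  have hal : a ≤ β * l := by
    have : a / β ≤ l := Nat.ceil_le.1 hl
    rwa [div_le_iff₀ hβ, mul_comm] at this
  calc (1 / 2 : ℝ) * ∑ y, |(P ^ l) x y - π y| ≤ (1 - β) ^ l := by linarith
    _ ≤ Real.exp (-β) ^ l := by
        gcongr
        have := Real.add_one_le_exp (-β)
        linarith
    _ = Real.exp (-(β * l)) := by rw [← Real.exp_nat_mul]; ring_nf
    _ ≤ Real.exp (-a) := Real.exp_le_exp.2 (by linarith)
    _ ≤ ε := hε

end Doeblin

/-! ### The independence Metropolis chain -/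

section Metropolis

variable {Ω : Type*} [Fintype Ω]

/-- The lazy Metropolis chain for the target proportional to `w`, with uniform proposals. -/
noncomputable def lazyMetropolis (w : Ω → ℝ) : Matrix Ω Ω ℝ := fun x y =>
  if x = y then 1 - ∑ z ∈ Finset.univ.erase x,
    1 / (2 * (Fintype.card Ω : ℝ)) * min 1 (w z / w x)
  else 1 / (2 * (Fintype.card Ω : ℝ)) * min 1 (w y / w x)

theorem lazyMetropolis_row (w : Ω → ℝ) (x : Ω) : ∑ y, lazyMetropolis w x y = 1 := by
  rw [← Finset.add_sum_erase _ _ (Finset.mem_univ x)]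
  have : ∑ y ∈ Finset.univ.erase x, lazyMetropolis w x y = ∑ z ∈ Finset.univ.erase x,
      1 / (2 * (Fintype.card Ω : ℝ)) * min 1 (w z / w x) :=
    Finset.sum_congr rfl fun y hy => if_neg (Finset.ne_of_mem_erase hy).symm
  rw [this, lazyMetropolis, if_pos rfl, sub_add_cancel]

theorem lazyMetropolis_reversible {w : Ω → ℝ} (hw : ∀ x, 0 < w x) (x y : Ω) :
    w x * lazyMetropolis w x y = w y * lazyMetropolis w y x := by
  have key : ∀ x y, w x * min 1 (w y / w x) = min (w x) (w y) := fun x y => by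
    rw [mul_min_of_nonneg _ _ (hw x).le, mul_one, mul_div_cancel₀ _ (hw x).ne']
  by_cases h : x = y
  · rw [h]
  · rw [lazyMetropolis, lazyMetropolis, if_neg h, if_neg (Ne.symm h), mul_left_comm, key,
      mul_left_comm, key, min_comm]

/-- The minorisation: the acceptance probability `min 1 (w y / w x)` is at least `w y / M`. -/
theorem lazyMetropolis_ge {w : Ω → ℝ} {M : ℝ} (hw : ∀ x, 0 < w x) (hM : ∀ x, w x ≤ M) (x y : Ω) :
    w y / (2 * Fintype.card Ω * M) ≤ lazyMetropolis w x y := by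
  have hcard : 0 < (Fintype.card Ω : ℝ) := by exact_mod_cast Fintype.card_pos_iff.2 ⟨x⟩
  have hMpos : 0 < M := (hw x).trans_le (hM x)
  have hyM : w y / M ≤ 1 := (div_le_one hMpos).2 (hM y)
  have hsplit : w y / (2 * Fintype.card Ω * M) = 1 / (2 * (Fintype.card Ω : ℝ)) * (w y / M) := by
    field_simp
  rw [hsplit]
  by_cases h : x = y
  · rw [lazyMetropolis, if_pos h]
    have hsum : ∑ z ∈ Finset.univ.erase x, 1 / (2 * (Fintype.card Ω : ℝ)) * min 1 (w z / w x) ≤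
        ∑ z ∈ Finset.univ.erase x, 1 / (2 * (Fintype.card Ω : ℝ)) :=
      Finset.sum_le_sum fun z _ => mul_le_of_le_one_right (by positivity) (min_le_left _ _)
    have htot : ∑ z ∈ Finset.univ.erase x, 1 / (2 * (Fintype.card Ω : ℝ)) +
        1 / (2 * (Fintype.card Ω : ℝ)) = 1 / 2 := by
      rw [Finset.sum_erase_add _ _ (Finset.mem_univ x), Finset.sum_const, Finset.card_univ,
        nsmul_eq_mul]
      field_simp
    have : 1 / (2 * (Fintype.card Ω : ℝ)) * (w y / M) ≤ 1 / (2 * (Fintype.card Ω : ℝ)) :=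
      mul_le_of_le_one_right (by positivity) hyM
    linarith
  · rw [lazyMetropolis, if_neg h]
    gcongr
    refine le_min hyM ?_
    have := hw x
    have := (hw y).le
    gcongr
    exact hM x

end Metropolis

/-! ### The number of steps of the walks -/

theorem maxDeg_pos (hG : G.Connected) (hV : 1 < Fintype.card V) : 1 ≤ maxDeg G := by
  have : Nontrivial V := Fintype.one_lt_card_iff_nontrivial.1 hV
  obtain ⟨x⟩ := hG.nonempty
  exact (hG.preconnected.degree_pos_of_nontrivial x).trans_le (G.degree_le_maxDegree x)

theorem maxDeg_le (hG : G.Connected) : maxDeg G ≤ Fintype.card V := by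
  have := hG.nonempty
  exact (G.maxDegree_lt_card_verts).le

/-- The minorisation constant `|E^(j)| / (j ^ 2 * Δ * |E^(j-1)|)` is at most one. -/
theorem card_stateEdge_succ_le (n : ℕ) :
    (Fintype.card (StateEdge G (n + 3)) : ℝ) ≤
      ((n + 3 : ℕ) : ℝ) ^ 2 * maxDeg G * Fintype.card (StateEdge G (n + 2)) := by
  have h1 := two_mul_card_le_sum_weight (G := G) n
  have h2 : ∑ e : StateEdge G (n + 2), weight G (edgeUnion G e) ≤
      ∑ e : StateEdge G (n + 2), ((n + 3 : ℕ) : ℚ) ^ 2 * maxDeg G :=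
    Finset.sum_le_sum fun e _ => weight_le (k := n + 1) _
  rw [Finset.sum_const, Finset.card_univ, nsmul_eq_mul] at h2
  have h3 : (Fintype.card (StateEdge G (n + 3)) : ℚ) ≤
      ((n + 3 : ℕ) : ℚ) ^ 2 * maxDeg G * Fintype.card (StateEdge G (n + 2)) := by
    have : (0 : ℚ) ≤ Fintype.card (StateEdge G (n + 3)) := Nat.cast_nonneg _
    linarith
  exact_mod_cast h3

theorem chain_eq_lazyMetropolis (n : ℕ) : chain G n =
    lazyMetropolis fun x : StateEdge G (n + 2) => (weight G (edgeUnion G x) : ℝ) := by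
  ext x y
  unfold chain lazyMetropolis
  congr
  exact Subsingleton.elim _ _

/-- The mixing time of level `j = n + 3` is at most `j ^ 2 * Δ * |E^(j-1)| / |E^(j)|` times
`log ε⁻¹`. The mean of `f` is at least `2 * |E^(j)| / |E^(j-1)|` and its maximum is at most
`j ^ 2 * Δ`, and twice their quotient is the inverse of the minorisation constant. -/
theorem mixSteps_le (hG : G.Connected) {n : ℕ} (hn : n + 3 < Fintype.card V) {ε a : ℝ}
    (ha : 0 ≤ a) (hε : Real.exp (-a) ≤ ε) :
    mixSteps G ε (n + 3) ≤ ⌈a * (((n + 3 : ℕ) : ℝ) ^ 2 * maxDeg G *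
      Fintype.card (StateEdge G (n + 2)) / Fintype.card (StateEdge G (n + 3)))⌉₊ := by
  set w : StateEdge G (n + 2) → ℝ := fun x => (weight G (edgeUnion G x) : ℝ) with hw
  set M : ℝ := ((n + 3 : ℕ) : ℝ) ^ 2 * maxDeg G with hM
  set W : ℝ := ∑ x, w x with hW
  have hwpos : ∀ x, 0 < w x := fun x => by
    have := weight_pos hG (k := n + 1) hn (edgeUnion G x)
    simp only [hw]
    exact_mod_cast this
  have hwM : ∀ x, w x ≤ M := fun x => by
    have := weight_le (k := n + 1) (edgeUnion G x)
    simp only [hw, hM]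
    exact_mod_cast this
  have hΔ : (0 : ℝ) < maxDeg G := by exact_mod_cast maxDeg_pos hG (by omega)
  have hMpos : 0 < M := by positivity
  have hN : (0 : ℝ) < Fintype.card (StateEdge G (n + 2)) := by
    exact_mod_cast card_stateEdge_pos hG (j := n + 2) (by omega) (by omega)
  have hN' : (0 : ℝ) < Fintype.card (StateEdge G (n + 3)) := by
    exact_mod_cast card_stateEdge_pos hG (j := n + 3) (by omega) hn
  have hWge : 2 * (Fintype.card (StateEdge G (n + 3)) : ℝ) ≤ W := by
    have := two_mul_card_le_sum_weight (G := G) n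
    simp only [hW, hw]
    exact_mod_cast this
  have hWpos : 0 < W := by linarith
  have hmix : mixingTime (lazyMetropolis w) (fun x => w x / W) ε ≤
      ⌈a / (W / (2 * Fintype.card (StateEdge G (n + 2)) * M))⌉₊ := by
    refine mixingTime_le_of_minorisation (by positivity) (fun x y => ?_) (lazyMetropolis_row w)
      (fun y => ?_) (fun x => (div_pos (hwpos x) hWpos).le) ?_ hε
    · refine le_trans (le_of_eq ?_) (lazyMetropolis_ge hwpos hwM x y)
      field_simp
    · have : ∀ x, w x / W * lazyMetropolis w x y = w y / W * lazyMetropolis w y x := fun x => by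
        rw [div_mul_eq_mul_div, lazyMetropolis_reversible hwpos, ← div_mul_eq_mul_div]
      simp only [this]
      rw [← Finset.mul_sum, lazyMetropolis_row, mul_one]
    · rw [← Finset.sum_div, div_self hWpos.ne']
  rw [mixSteps, chain_eq_lazyMetropolis]
  refine hmix.trans (Nat.ceil_le_ceil ?_)
  rw [div_eq_mul_inv, inv_div]
  refine mul_le_mul_of_nonneg_left ?_ ha
  rw [div_le_div_iff₀ hWpos hN']
  have : 0 ≤ Fintype.card (StateEdge G (n + 2)) * M := by positivity
  nlinarith

theorem one_le_log_card (hV : 3 < Fintype.card V) : 1 ≤ Real.log (Fintype.card V) := by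
  rw [Real.le_log_iff_exp_le (by positivity)]
  have h1 := Real.exp_one_lt_d9
  have h2 : (4 : ℝ) ≤ Fintype.card V := by exact_mod_cast hV
  linarith

/-- The number of steps at level `j` in a form that telescopes: multiplied by `|E^(j)|` it is
bounded in terms of `|E^(j-1)|`. -/
theorem mixSteps_add_one_le (hG : G.Connected) {n : ℕ} (hn : n + 3 < Fintype.card V) {A ε : ℝ}
    (hA : 0 < A) (hε : (Fintype.card V : ℝ) ^ (-A) ≤ ε) :
    ((mixSteps G ε (n + 3) : ℝ) + 1) * Fintype.card (StateEdge G (n + 3)) ≤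
      (2 * A + 8) * ((n + 3 : ℕ) : ℝ) ^ 2 * maxDeg G * Real.log (Fintype.card V) *
        Fintype.card (StateEdge G (n + 2)) := by
  set L := Real.log (Fintype.card V) with hL
  have hL1 : 1 ≤ L := one_le_log_card (by omega)
  set e : ℝ := (Fintype.card (StateEdge G (n + 2)) : ℝ)
  set e' : ℝ := (Fintype.card (StateEdge G (n + 3)) : ℝ) with he'
  have hpos : 0 < e' := by
    rw [he']
    exact_mod_cast card_stateEdge_pos hG (j := n + 3) (by omega) hn
  have hle : e' ≤ ((n + 3 : ℕ) : ℝ) ^ 2 * maxDeg G * e := card_stateEdge_succ_le n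
  set X : ℝ := ((n + 3 : ℕ) : ℝ) ^ 2 * maxDeg G * e with hX
  have hexp : Real.exp (-(A * L)) ≤ ε := by
    refine le_trans (le_of_eq ?_) hε
    rw [Real.rpow_def_of_pos (by exact_mod_cast (by omega : 0 < Fintype.card V)), ← hL]
    ring_nf
  have h1 : (mixSteps G ε (n + 3) : ℝ) ≤ A * L * (X / e') + 1 := by
    refine le_trans (Nat.cast_le.2 (mixSteps_le hG hn (by positivity) hexp)) ?_
    refine (Nat.ceil_lt_add_one ?_).le
    have : 0 ≤ X := hpos.le.trans hle
    positivity
  have h2 : A * L * (X / e') * e' = A * L * X := by field_simp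
  have hXL : X ≤ L * X := le_mul_of_one_le_left (hpos.le.trans hle) hL1
  have hAX : 0 ≤ A * (L * X) := by
    have : 0 ≤ X := hpos.le.trans hle
    positivity
  calc ((mixSteps G ε (n + 3) : ℝ) + 1) * e' ≤ (A * L * (X / e') + 1 + 1) * e' := by gcongr
    _ = A * L * X + 2 * e' := by rw [add_assoc, add_mul, h2]; ring
    _ ≤ (2 * A + 8) * (L * X) := by nlinarith
    _ = _ := by rw [hX]; ring

theorem explicitSteps_add_one_le (hG : G.Connected) {j : ℕ} (hj : 3 ≤ j)
    (hjV : j < Fintype.card V) {A ε : ℝ} (hA : 0 < A)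
    (hε : (Fintype.card V : ℝ) ^ (-A) ≤ ε) :
    (explicitSteps G ε j : ℝ) + 1 ≤
      (2 * A + 8) * (j : ℝ) ^ 2 * maxDeg G * Real.log (Fintype.card V) := by
  set L := Real.log (Fintype.card V) with hL
  have hL1 : 1 ≤ L := one_le_log_card (by omega)
  have hΔ1 : (1 : ℝ) ≤ maxDeg G := by exact_mod_cast maxDeg_pos hG (by omega)
  have hj3 : (3 : ℝ) ≤ j := by exact_mod_cast hj
  have hlogj : Real.log j ≤ L :=
    Real.log_le_log (by positivity) (by exact_mod_cast hjV.le)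
  have hlogΔ : Real.log (maxDeg G) ≤ L :=
    Real.log_le_log (by positivity) (by exact_mod_cast maxDeg_le hG)
  have hlogε : Real.log ε⁻¹ ≤ A * L := by
    have hV : (0 : ℝ) < Fintype.card V := by exact_mod_cast (by omega : 0 < Fintype.card V)
    have := Real.log_le_log (Real.rpow_pos_of_pos hV _) hε
    rw [Real.log_rpow hV] at this
    rw [Real.log_inv]
    linarith
  set D : ℝ := (maxDeg G : ℝ)
  have hin : (j : ℝ) * L + 3 * Real.log j + Real.log D + Real.log ε⁻¹ ≤ (A + 3) * (j * L) := by
    have hjL : 3 * L ≤ j * L := by gcongr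
    have : A * (3 * L) ≤ A * (j * L) := by gcongr
    have : 0 ≤ A * L := by positivity
    nlinarith
  have hceil : (explicitSteps G ε j : ℝ) ≤ 2 * j * D * ((A + 3) * (j * L)) + 1 := by
    refine le_trans (Nat.cast_le.2 (Nat.ceil_le_ceil ?_)) (Nat.ceil_lt_add_one ?_).le
    · exact mul_le_mul_of_nonneg_left hin (by positivity)
    · positivity
  have hbig : 1 ≤ (j : ℝ) ^ 2 * D * L :=
    one_le_mul_of_one_le_of_one_le (one_le_mul_of_one_le_of_one_le (by nlinarith) hΔ1) hL1
  nlinarith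

/-! ### Running times of the sampler -/

theorem runsIn_extend (hG : G.Connected) (κ : ℕ → ℕ) {n : ℕ} (hn : n + 2 < Fintype.card V)
    (v : KSub G (n + 2)) : (extend G κ v).RunsIn (κ (n + 2) + 1) := by
  have hpos := stateDeg_pos hG (by omega) hn v
  unfold stateDeg at hpos
  rw [SimpleGraph.degree_pos_iff_exists_adj] at hpos
  obtain ⟨u, hu⟩ := hpos
  refine ((Prog.RunsIn.spend _).bind fun _ => (Prog.RunsIn.draw ⟨⟨u, hu⟩, one_ne_zero⟩).bind
    fun _ => Prog.RunsIn.ret _).mono (by simp)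

theorem runsIn_queryDeg (κ : ℕ → ℕ) {k : ℕ} (H : KSub G k) : (queryDeg G κ H).RunsIn (κ k) :=
  ((Prog.RunsIn.spend _).bind fun _ => Prog.RunsIn.ret _).mono (by simp)

theorem runsIn_queryNumSub (κ : ℕ → ℕ) {k : ℕ} (H : KSub G k) :
    (queryNumSub G κ H).RunsIn (κ k) :=
  ((Prog.RunsIn.spend _).bind fun _ => Prog.RunsIn.ret _).mono (by simp)

theorem expect_queryNumSub (κ : ℕ → ℕ) {k : ℕ} (H : KSub G k) (g : ℕ → ℝ≥0∞) :
    (queryNumSub G κ H).expect g = g (numSub G H) := by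
  unfold queryNumSub
  rw [Prog.expect_bind]
  simp only [Prog.expect_ret]
  rw [Prog.expect_const, (Prog.RunsIn.spend _).1, one_mul]

theorem runsIn_propose (hG : G.Connected) (κ : ℕ → ℕ) {n : ℕ} (hn : n + 2 < Fintype.card V)
    {sample : Prog (KSub G (n + 2))} {B : ℝ≥0∞} (hs : sample.RunsIn B) :
    (propose G κ sample).RunsIn (B + κ (n + 2) + 2 * κ (n + 3) + 1) := by
  refine (hs.bind fun v => (runsIn_extend hG κ hn v).bind fun H => (runsIn_queryDeg κ H).bind
    fun d => (runsIn_queryNumSub κ H).bind fun m => Prog.RunsIn.ret _).mono (le_of_eq ?_)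
  ring

theorem runsIn_walkStep (hG : G.Connected) (κ : ℕ → ℕ) {n : ℕ} (hn : n + 2 < Fintype.card V)
    {sample : Prog (KSub G (n + 2))} {B : ℝ≥0∞} (hs : sample.RunsIn B)
    (c : KSub G (n + 3) × ℚ) :
    (walkStep G κ sample c).RunsIn (B + κ (n + 2) + 2 * κ (n + 3) + 3) := by
  refine ((Prog.RunsIn.flip _).bind (B' := B + κ (n + 2) + 2 * κ (n + 3) + 2)
    fun skip => ?_).mono (le_of_eq (by ring))
  split_ifs
  · exact (Prog.RunsIn.ret _).mono zero_le
  · exact ((runsIn_propose hG κ hn hs).bind fun x => (Prog.RunsIn.flip _).bind fun accept =>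
      Prog.RunsIn.ret _).mono (le_of_eq (by ring))

/-- An upper bound for the expected running time of `DegreePropSampling+` at levels `j ≥ 2`: one
proposal and `T j` steps, each of which costs at most a sample of the level below, the queries, and
three random draws or tests. The value `1` at levels `0` and `1` plays no role. -/
def timeBound (κ T : ℕ → ℕ) : ℕ → ℕ
  | n + 3 => (T (n + 3) + 1) * (timeBound κ T (n + 2) + κ (n + 2) + 2 * κ (n + 3) + 3)
  | _ => 1

/-- There is an edge with an end of degree at least two, so the draw at level two does not get
stuck. -/
theorem exists_edge_weight_ne_zero (hG : G.Connected) (hV : 2 < Fintype.card V) :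
    ∃ e : KSub G 2, (∑ x ∈ e.1, G.degree x) - 2 ≠ 0 := by
  obtain ⟨e⟩ := Fintype.card_pos_iff.1 (card_kSub_pos hG (j := 2) (by omega) (by omega))
  refine ⟨e, ?_⟩
  have hss : e.1 ⊂ Finset.univ := by
    refine (Finset.subset_univ _).ssubset_of_ne fun h => ?_
    have := e.2.1
    rw [h, Finset.card_univ] at this
    omega
  have hpos : ∀ z ∈ e.1, ∃ z' ∈ e.1, G.Adj z z' := by
    intro z hz
    have hss : {z} ⊂ e.1 := by
      refine (Finset.singleton_subset_iff.2 hz).ssubset_of_ne fun h => ?_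
      have := e.2.1
      rw [← h, Finset.card_singleton] at this
      omega
    obtain ⟨y, hy, x, hx, -, hyx⟩ := exists_adj_of_ssubset e.2.2 ⟨z, by simp⟩ hss
    rw [Finset.mem_singleton] at hy
    exact ⟨x, hx, hy ▸ hyx⟩
  have hne : e.1.Nonempty := by rw [← Finset.card_pos, e.2.1]; omega
  obtain ⟨y, hy, x, -, hx, hyx⟩ := exists_adj_of_ssubset (connected_induce_univ hG) hne hss
  obtain ⟨y', hy', hyy'⟩ := hpos y hy
  have hsub : ({x, y'} : Finset V) ⊆ G.neighborFinset y := by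
    intro z hz
    rw [SimpleGraph.mem_neighborFinset]
    rcases Finset.mem_insert.1 hz with rfl | hz
    · exact hyx
    · rw [Finset.mem_singleton.1 hz]
      exact hyy'
  have h2 : 2 ≤ G.degree y := by
    rw [← SimpleGraph.card_neighborFinset_eq_degree,
      ← Finset.card_pair (show x ≠ y' from fun h => hx (h ▸ hy'))]
    exact Finset.card_le_card hsub
  have h1 : 1 ≤ ∑ z ∈ e.1.erase y, G.degree z := by
    have hy'e : y' ∈ e.1.erase y := Finset.mem_erase.2 ⟨hyy'.ne', hy'⟩
    obtain ⟨z, -, hz⟩ := hpos y' hy'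
    have hd : 0 < G.degree y' := by
      rw [SimpleGraph.degree_pos_iff_exists_adj]
      exact ⟨z, hz⟩
    exact hd.trans_le (Finset.single_le_sum (f := fun z => G.degree z) (fun _ _ => Nat.zero_le _)
      hy'e)
  have := Finset.add_sum_erase e.1 (fun z => G.degree z) hy
  omega

theorem runsIn_degreePropSamplingPlus (hG : G.Connected) (κ T : ℕ → ℕ) (n : ℕ)
    (hn : n + 2 < Fintype.card V) :
    (degreePropSamplingPlus G κ T (n + 2)).RunsIn (timeBound κ T (n + 2)) := by
  induction n with
  | zero =>
    refine (Prog.RunsIn.draw (exists_edge_weight_ne_zero hG hn)).mono ?_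
    simp [timeBound]
  | succ n ih =>
    have ih := ih (by omega)
    rw [degreePropSamplingPlus]
    refine ((runsIn_propose hG κ (by omega) ih).bind fun c => (Prog.RunsIn.iterate
      (runsIn_walkStep hG κ (by omega) ih) (T (n + 3)) c).bind fun x => Prog.RunsIn.ret _).mono ?_
    rw [add_zero, timeBound]
    push_cast
    rw [add_mul, one_mul, add_comm]
    gcongr
    norm_num

/-- A round of `RSS+` succeeds with probability at least `1 / (k choose 2)`, since a subgraph with
`k` nodes has at least two and at most `k` connected subgraphs with `k - 1` nodes. -/
theorem runsIn_rssPlus (hG : G.Connected) (κ T : ℕ → ℕ) (n : ℕ) (hn : n + 3 < Fintype.card V) :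
    (rssPlus G κ T (n + 3)).RunsIn (((n + 3).choose 2 *
      (timeBound κ T (n + 2) + κ (n + 2) + κ (n + 3) + 2) : ℕ) : ℝ≥0∞) := by
  have hdps := runsIn_degreePropSamplingPlus hG κ T n (by omega)
  have hext := runsIn_extend hG κ (n := n) (by omega)
  have hc0 : 0 < (n + 3).choose 2 := Nat.choose_pos (by omega)
  have hs0 : (((n + 3).choose 2 : ℕ) : ℝ≥0∞)⁻¹ ≠ 0 :=
    ENNReal.inv_ne_zero.2 (ENNReal.natCast_ne_top _)
  rw [rssPlus]
  refine (Prog.RunsIn.repeatUntil (s := (((n + 3).choose 2 : ℕ) : ℝ≥0∞)⁻¹)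
    (hdps.bind fun v => (hext v).bind fun H => (runsIn_queryNumSub κ H).bind fun m =>
      (Prog.RunsIn.flip _).bind fun accept => Prog.RunsIn.ret _) hs0 ?_).mono (le_of_eq ?_)
  · have hconst : ∀ {γ : Type _} {p : Prog γ} {B c : ℝ≥0∞} {g : γ → ℝ≥0∞}, p.RunsIn B →
        (∀ a, c ≤ g a) → c ≤ p.expect g := fun {γ p B c g} hp hg => by
      refine le_trans ?_ (p.expect_mono hg)
      rw [Prog.expect_const, hp.1, one_mul]
    rw [Prog.expect_bind]
    refine hconst hdps fun v => ?_
    rw [Prog.expect_bind]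
    refine hconst (hext v) fun H => ?_
    rw [Prog.expect_bind, expect_queryNumSub, Prog.expect_bind]
    refine le_trans ?_ (Prog.le_expect_flip _ _)
    simp only [Prog.expect_ret, if_true, Option.elim, mul_one]
    have h1 : (1 : ℝ) ≤ (numSub G H).choose 2 := by
      exact_mod_cast one_le_choose_numSub (k := n + 1) H
    have h2 : ((numSub G H).choose 2 : ℝ) ≤ (n + 3).choose 2 := by
      exact_mod_cast Nat.choose_le_choose 2 (numSub_le (k := n + 2) H)
    rw [← ENNReal.ofReal_natCast, ← ENNReal.ofReal_inv_of_pos (by exact_mod_cast hc0)]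
    refine ENNReal.ofReal_le_ofReal (le_min ?_ ?_)
    · push_cast
      rw [one_div]
      exact inv_anti₀ (by linarith) h2
    · exact inv_le_one_of_one_le₀ (h1.trans h2)
  · rw [inv_inv]
    push_cast
    ring

/-! ### Summing the recursion -/

theorem queryCost_le {κ : ℕ → ℕ} {K : ℕ} (h : QueryCost G κ K) (hΔ : 1 ≤ maxDeg G) {j : ℕ}
    (hj : 1 ≤ j) : κ j ≤ K * j ^ 4 * maxDeg G := by
  rcases le_or_gt j 3 with h3 | h3
  · refine (h.1 j h3).trans ?_
    rw [mul_assoc]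
    exact Nat.le_mul_of_pos_right _ (by positivity)
  · exact h.2 j h3

/-- The leading term of the running time of level `n + 2`: four times the product of `r * j ^ 2`
over `3 ≤ j ≤ n + 2`. Here `r` is a multiple of `Δ * log |V|`, so that `r * j ^ 2` bounds the
number of steps at level `j`, up to quotients that telescope. -/
noncomputable def leadingTerm (r : ℝ) (n : ℕ) : ℝ := r ^ n * ((n + 2).factorial : ℝ) ^ 2

theorem leadingTerm_succ (r : ℝ) (n : ℕ) :
    leadingTerm r (n + 1) = r * ((n + 3 : ℕ) : ℝ) ^ 2 * leadingTerm r n := by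
  unfold leadingTerm
  rw [show n + 1 + 2 = (n + 2) + 1 by ring, Nat.factorial_succ]
  push_cast
  ring

theorem one_le_factorial_sq (n : ℕ) : (1 : ℝ) ≤ ((n + 2).factorial : ℝ) ^ 2 :=
  one_le_pow₀ (by exact_mod_cast Nat.one_le_iff_ne_zero.2 (Nat.factorial_ne_zero _))

/-- The cost of a step beyond the sample from the level below is dominated by the leading term of
that level, up to a factor polynomial in the level. -/
theorem queries_le {κ : ℕ → ℕ} {K : ℕ} (h : QueryCost G κ K) (hΔ : 1 ≤ maxDeg G) {r : ℝ}
    (hr : (maxDeg G : ℝ) ≤ r) (n : ℕ) :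
    (κ (n + 2) + 2 * κ (n + 3) + 3 : ℝ) ≤
      (3 * K + 3) * ((n + 3 : ℕ) : ℝ) ^ 4 * leadingTerm r n := by
  have hΔ' : (1 : ℝ) ≤ maxDeg G := by exact_mod_cast hΔ
  have hf := one_le_factorial_sq n
  have hn4 : (1 : ℝ) ≤ ((n + 3 : ℕ) : ℝ) ^ 4 :=
    one_le_pow₀ (by exact_mod_cast (by omega : 1 ≤ n + 3))
  rcases n with _ | n
  · -- at level three the queries cost a constant, without the factor `Δ`
    have h2 : (κ 2 : ℝ) ≤ K := by exact_mod_cast h.1 2 (by omega)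
    have h3 : (κ 3 : ℝ) ≤ K := by exact_mod_cast h.1 3 (by omega)
    have hlt : 1 ≤ leadingTerm r 0 := by simp [leadingTerm]
    have : (3 * K + 3 : ℝ) ≤ (3 * K + 3) * ((0 + 3 : ℕ) : ℝ) ^ 4 * leadingTerm r 0 := by
      rw [mul_assoc]
      exact le_mul_of_one_le_right (by positivity) (one_le_mul_of_one_le_of_one_le hn4 hlt)
    simp only [zero_add] at this ⊢
    linarith
  · have h2 : (κ (n + 3) : ℝ) ≤ K * ((n + 4 : ℕ) : ℝ) ^ 4 * maxDeg G := by
      have := queryCost_le h hΔ (j := n + 3) (by omega)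
      have h' : (κ (n + 3) : ℝ) ≤ K * ((n + 3 : ℕ) : ℝ) ^ 4 * maxDeg G := by exact_mod_cast this
      refine h'.trans ?_
      gcongr
      omega
    have h3 : (κ (n + 4) : ℝ) ≤ K * ((n + 4 : ℕ) : ℝ) ^ 4 * maxDeg G := by
      have := queryCost_le h hΔ (j := n + 4) (by omega)
      exact_mod_cast this
    have hlt : (maxDeg G : ℝ) ≤ leadingTerm r (n + 1) := by
      unfold leadingTerm
      have hr1 : 1 ≤ r := hΔ'.trans hr
      calc (maxDeg G : ℝ) ≤ r := hr
        _ ≤ r ^ (n + 1) := le_self_pow₀ hr1 (by omega)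
        _ ≤ _ := le_mul_of_one_le_right (by positivity) hf
    have hone : (1 : ℝ) ≤ ((n + 4 : ℕ) : ℝ) ^ 4 * maxDeg G :=
      one_le_mul_of_one_le_of_one_le hn4 hΔ'
    calc (κ (n + 1 + 2) + 2 * κ (n + 1 + 3) + 3 : ℝ)
        ≤ (3 * K + 3) * ((n + 4 : ℕ) : ℝ) ^ 4 * maxDeg G := by
          have e1 : n + 1 + 2 = n + 3 := by ring
          have e2 : n + 1 + 3 = n + 4 := by ring
          rw [e1, e2]
          linarith
      _ ≤ _ := by gcongr

/-- The recursion for the running times, with weights `e` whose quotients may enter the bounds for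
the numbers of steps: as these quotients telescope, only the largest quotient `Q` of a weight and
the last one enters the result. -/
theorem timeBound_mul_le {κ T : ℕ → ℕ} {K m : ℕ} (h : QueryCost G κ K) (hΔ : 1 ≤ maxDeg G)
    {r Q : ℝ} (hr : (maxDeg G : ℝ) ≤ r) {e : ℕ → ℝ} (he : ∀ n ≤ m, 0 < e n)
    (hQ : ∀ n ≤ m, e n ≤ Q * e m)
    (hT : ∀ n < m, ((T (n + 3) : ℝ) + 1) * e (n + 1) ≤ r * ((n + 3 : ℕ) : ℝ) ^ 2 * e n)
    (n : ℕ) (hn : n ≤ m) :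
    (timeBound κ T (n + 2) : ℝ) * e n ≤
      leadingTerm r n * (Q * e m) * (1 + (3 * K + 3) * ((n + 2 : ℕ) : ℝ) ^ 5) := by
  have hr0 : 0 < r := lt_of_lt_of_le (by exact_mod_cast hΔ) hr
  have hlt0 : ∀ i, 0 < leadingTerm r i := fun i => by
    unfold leadingTerm
    have := one_le_factorial_sq i
    positivity
  have hE : 0 < Q * e m := (he m le_rfl).trans_le (hQ m le_rfl)
  induction n with
  | zero =>
    have h1 : 1 ≤ leadingTerm r 0 := by simp [leadingTerm]
    have h2 : (1 : ℝ) ≤ 1 + (3 * K + 3) * ((0 + 2 : ℕ) : ℝ) ^ 5 := by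
      have : (0 : ℝ) ≤ (3 * K + 3) * ((0 + 2 : ℕ) : ℝ) ^ 5 := by positivity
      linarith
    calc (timeBound κ T 2 : ℝ) * e 0 = e 0 := by simp [timeBound]
      _ ≤ Q * e m := hQ 0 hn
      _ ≤ leadingTerm r 0 * (Q * e m) := le_mul_of_one_le_left hE.le h1
      _ ≤ _ := le_mul_of_one_le_right (mul_pos (hlt0 0) hE).le h2
  | succ n ih =>
    have ih := ih (by omega)
    set a : ℝ := κ (n + 2) + 2 * κ (n + 3) + 3 with ha
    have haq : a ≤ (3 * K + 3) * ((n + 3 : ℕ) : ℝ) ^ 4 * leadingTerm r n := queries_le h hΔ hr n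
    have ha0 : 0 ≤ a := by positivity
    -- the added query costs `j ^ 4` of all levels sum to at most `j ^ 5`
    have hpow : ((n + 2 : ℕ) : ℝ) ^ 5 + ((n + 3 : ℕ) : ℝ) ^ 4 ≤ ((n + 3 : ℕ) : ℝ) ^ 5 := by
      have h1 : ((n + 2 : ℕ) : ℝ) ^ 4 ≤ ((n + 3 : ℕ) : ℝ) ^ 4 := by gcongr; omega
      have h2 : ((n + 3 : ℕ) : ℝ) = ((n + 2 : ℕ) : ℝ) + 1 := by push_cast; ring
      calc ((n + 2 : ℕ) : ℝ) ^ 5 + ((n + 3 : ℕ) : ℝ) ^ 4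
          = ((n + 2 : ℕ) : ℝ) * ((n + 2 : ℕ) : ℝ) ^ 4 + ((n + 3 : ℕ) : ℝ) ^ 4 := by ring
        _ ≤ ((n + 2 : ℕ) : ℝ) * ((n + 3 : ℕ) : ℝ) ^ 4 + ((n + 3 : ℕ) : ℝ) ^ 4 := by gcongr
        _ = (((n + 2 : ℕ) : ℝ) + 1) * ((n + 3 : ℕ) : ℝ) ^ 4 := by ring
        _ = ((n + 3 : ℕ) : ℝ) ^ 5 := by rw [← h2]; ring
    calc (timeBound κ T (n + 1 + 2) : ℝ) * e (n + 1)
        = ((T (n + 3) : ℝ) + 1) * e (n + 1) * (timeBound κ T (n + 2) + a) := by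
          rw [show n + 1 + 2 = n + 3 by ring, timeBound, ha]
          push_cast
          ring
      _ ≤ r * ((n + 3 : ℕ) : ℝ) ^ 2 * e n * (timeBound κ T (n + 2) + a) := by
          exact mul_le_mul_of_nonneg_right (hT n (by omega)) (by positivity)
      _ = r * ((n + 3 : ℕ) : ℝ) ^ 2 * (timeBound κ T (n + 2) * e n + e n * a) := by ring
      _ ≤ r * ((n + 3 : ℕ) : ℝ) ^ 2 *
          (leadingTerm r n * (Q * e m) * (1 + (3 * K + 3) * ((n + 2 : ℕ) : ℝ) ^ 5) +
            Q * e m * ((3 * K + 3) * ((n + 3 : ℕ) : ℝ) ^ 4 * leadingTerm r n)) := by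
          gcongr
          exact hQ n (by omega)
      _ = leadingTerm r (n + 1) * (Q * e m) *
          (1 + (3 * K + 3) * (((n + 2 : ℕ) : ℝ) ^ 5 + ((n + 3 : ℕ) : ℝ) ^ 4)) := by
          rw [leadingTerm_succ]
          ring
      _ ≤ _ := by
          have := hlt0 (n + 1)
          gcongr

/-- The running time of `RSS+` at level `m + 3`, when the numbers of steps are bounded as in
`timeBound_mul_le`, with an exponential bound for the quotients of weights. -/
theorem total_le {κ T : ℕ → ℕ} {K m : ℕ} (h : QueryCost G κ K) (hΔ : 1 ≤ maxDeg G)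
    {r : ℝ} (hr : (maxDeg G : ℝ) ≤ r) {e : ℕ → ℝ} (he : ∀ n ≤ m, 0 < e n)
    (hQ : ∀ n ≤ m, e n ≤ 8 ^ (m + 3) * e m)
    (hT : ∀ n < m, ((T (n + 3) : ℝ) + 1) * e (n + 1) ≤ r * ((n + 3 : ℕ) : ℝ) ^ 2 * e n) :
    (((m + 3).choose 2 * (timeBound κ T (m + 2) + κ (m + 2) + κ (m + 3) + 2) : ℕ) : ℝ) ≤
      (6 * K + 7) * 256 ^ (m + 3) * ((m + 3 : ℕ) : ℝ) ^ 2 * leadingTerm r m := by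
  have hem := he m le_rfl
  have hr0 : 0 < r := lt_of_lt_of_le (by exact_mod_cast hΔ) hr
  set k : ℝ := ((m + 3 : ℕ) : ℝ) with hk
  have hk1 : 1 ≤ k := by rw [hk]; exact_mod_cast (by omega : 1 ≤ m + 3)
  have hk2 : k ≤ 2 ^ (m + 3) := by
    rw [hk]
    exact_mod_cast Nat.lt_two_pow_self.le
  have hlt0 : 0 < leadingTerm r m := by
    unfold leadingTerm
    have := one_le_factorial_sq m
    positivity
  have hk5 : k ^ 5 ≤ 32 ^ (m + 3) := by
    calc k ^ 5 ≤ (2 ^ (m + 3)) ^ 5 := by gcongr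
      _ = 32 ^ (m + 3) := by rw [← pow_mul, mul_comm, pow_mul]; norm_num
  have hS : (timeBound κ T (m + 2) : ℝ) ≤
      leadingTerm r m * 8 ^ (m + 3) * ((3 * K + 4) * 32 ^ (m + 3)) := by
    have h1 := timeBound_mul_le h hΔ hr he hQ hT m le_rfl
    have h2 : (timeBound κ T (m + 2) : ℝ) ≤
        leadingTerm r m * 8 ^ (m + 3) * (1 + (3 * K + 3) * ((m + 2 : ℕ) : ℝ) ^ 5) := by
      refine le_of_mul_le_mul_right (h1.trans (le_of_eq ?_)) hem
      ring
    refine h2.trans ?_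
    gcongr
    have h3 : ((m + 2 : ℕ) : ℝ) ^ 5 ≤ 32 ^ (m + 3) := by
      refine le_trans ?_ hk5
      rw [hk]
      gcongr
      omega
    have h4 : (1 : ℝ) ≤ 32 ^ (m + 3) := one_le_pow₀ (by norm_num)
    have h5 : (3 * (K : ℝ) + 3) * ((m + 2 : ℕ) : ℝ) ^ 5 ≤ (3 * K + 3) * 32 ^ (m + 3) := by gcongr
    linarith
  have hq : (κ (m + 2) + κ (m + 3) + 2 : ℝ) ≤
      (3 * K + 3) * 256 ^ (m + 3) * leadingTerm r m := by
    have h1 := queries_le h hΔ hr m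
    have h2 : k ^ 4 ≤ 256 ^ (m + 3) := by
      calc k ^ 4 ≤ k ^ 5 := pow_le_pow_right₀ hk1 (by norm_num)
        _ ≤ 32 ^ (m + 3) := hk5
        _ ≤ 256 ^ (m + 3) := by gcongr; norm_num
    have h3 : (3 * (K : ℝ) + 3) * k ^ 4 * leadingTerm r m ≤
        (3 * K + 3) * 256 ^ (m + 3) * leadingTerm r m := by gcongr
    have h4 : (0 : ℝ) ≤ κ (m + 3) := Nat.cast_nonneg _
    linarith
  have h256 : (8 : ℝ) ^ (m + 3) * 32 ^ (m + 3) = 256 ^ (m + 3) := by rw [← mul_pow]; norm_num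
  have hch : ((m + 3).choose 2 : ℝ) ≤ k ^ 2 := by
    rw [hk]
    exact_mod_cast Nat.choose_le_pow (m + 3) 2
  calc (((m + 3).choose 2 * (timeBound κ T (m + 2) + κ (m + 2) + κ (m + 3) + 2) : ℕ) : ℝ)
      = ((m + 3).choose 2 : ℝ) *
        (timeBound κ T (m + 2) + (κ (m + 2) + κ (m + 3) + 2)) := by push_cast; ring
    _ ≤ k ^ 2 * (leadingTerm r m * 8 ^ (m + 3) * ((3 * K + 4) * 32 ^ (m + 3)) +
        (3 * K + 3) * 256 ^ (m + 3) * leadingTerm r m) := by gcongr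
    _ = _ := by rw [← h256]; ring

/-- For the mixing times the weights are the numbers of edges of the state graphs; for the explicit
numbers of steps no weights are needed. -/
theorem total_le_leadingTerm (hG : G.Connected) {A ε : ℝ} (hA : 0 < A) {K m : ℕ} {κ T : ℕ → ℕ}
    (hkV : m + 3 < Fintype.card V) (hε : (Fintype.card V : ℝ) ^ (-A) ≤ ε) (hκ : QueryCost G κ K)
    (hT : T = mixSteps G ε ∨ T = explicitSteps G ε) :
    (((m + 3).choose 2 * (timeBound κ T (m + 2) + κ (m + 2) + κ (m + 3) + 2) : ℕ) : ℝ) ≤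
      (6 * K + 7) * 256 ^ (m + 3) * ((m + 3 : ℕ) : ℝ) ^ 2 *
        leadingTerm ((2 * A + 8) * maxDeg G * Real.log (Fintype.card V)) m := by
  have hΔ := maxDeg_pos hG (by omega)
  have hΔ' : (1 : ℝ) ≤ maxDeg G := by exact_mod_cast hΔ
  have hL := one_le_log_card (V := V) (by omega)
  set r : ℝ := (2 * A + 8) * maxDeg G * Real.log (Fintype.card V) with hr_def
  have hr : (maxDeg G : ℝ) ≤ r := by
    rw [hr_def, mul_right_comm]
    exact le_mul_of_one_le_left (by positivity)
      (one_le_mul_of_one_le_of_one_le (by linarith) hL)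
  rcases hT with rfl | rfl
  · refine total_le hκ hΔ hr
      (e := fun n => (Fintype.card (StateEdge G (n + 2)) : ℝ)) ?_ ?_ ?_
    · intro n hn
      exact_mod_cast card_stateEdge_pos hG (j := n + 2) (by omega) (by omega)
    · intro n hn
      have h1 := card_stateEdge_le_of_le hG (i := n + 2) (j := m + 2) (by omega) (by omega)
        (by omega)
      exact_mod_cast h1
    · intro n hn
      refine (mixSteps_add_one_le hG (n := n) (by omega) hA hε).trans (le_of_eq ?_)
      rw [hr_def]
      ring
  · refine total_le hκ hΔ hr (e := fun _ => 1) (fun _ _ => one_pos) ?_ ?_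
    · intro n _
      rw [mul_one]
      exact one_le_pow₀ (by norm_num)
    · intro n hn
      have := explicitSteps_add_one_le hG (j := n + 3) (by omega) (by omega) hA hε
      rw [mul_one, mul_one]
      refine this.trans (le_of_eq ?_)
      rw [hr_def]
      ring

end RSS

theorem mainTheorem2 (A : ℝ) (hA : 0 < A) (K : ℕ) :
    ∃ C c : ℝ, 0 < C ∧ 0 < c ∧
      ∀ (V : Type*) [Fintype V] (G : SimpleGraph V) (k : ℕ) (ε : ℝ) (κ : ℕ → ℕ),
        G.Connected → 3 ≤ k → k < Fintype.card V →
        0 < ε → (Fintype.card V : ℝ) ^ (-A) ≤ ε → RSS.QueryCost G κ K →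
        ∀ T : ℕ → ℕ, T = RSS.mixSteps G ε ∨ T = RSS.explicitSteps G ε →
          RSS.RunsInExpectedTime (RSS.rssPlus G κ T k)
            (C * (c ^ (k - 3) * (k : ℝ) ^ 2 * ((k - 1).factorial : ℝ) ^ 2 *
              (RSS.maxDeg G : ℝ) ^ (k - 3) * Real.log (Fintype.card V) ^ (k - 3))) := by
  refine ⟨(6 * K + 7) * 256 ^ 3, 256 * (2 * A + 8), by positivity, by positivity, ?_⟩
  intro V _ G k ε κ hG hk hkV _ hε hκ T hT
  obtain ⟨m, rfl⟩ := Nat.exists_eq_add_of_le' hk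
  have htotal := RSS.total_le_leadingTerm hG hA hkV hε hκ hT
  obtain ⟨h1, h2⟩ := RSS.runsIn_rssPlus hG κ T m hkV
  refine ⟨h1, h2.trans ?_⟩
  rw [← ENNReal.ofReal_natCast]
  refine ENNReal.ofReal_le_ofReal (htotal.trans (le_of_eq ?_))
  rw [RSS.leadingTerm, show m + 3 - 3 = m by omega, show m + 3 - 1 = m + 2 by omega,
    pow_add, mul_pow, mul_pow, mul_pow]
  ring
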